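/- Let $q$ be an indeterminate (or, more generally, a non-zero element of a field that is not a root of unity), and let $k\ge 1$ and $1\le a\le k+1$ be integers. For $n\in\mathbb{Z}$ let $(x)_n=\prod_{i=0}^{n-1}(1-xq^i)$ if $n\ge 0$ and $(x)_n=\prod_{i=1}^{-n}(1-xq^{-i})^{-1}$ if $n<0$, and for $L,m\in\mathbb{Z}$ let $\left[{L\atop m}\right]=(q^{L-m+1})_m/(q)_m$ if $m\ge 0$ and $\left[{L\atop m}\right]=0$ if $m<0$. Let $T$ be the $k\times k$ matrix with entries $T_{i,j}=\delta_{i,j}(2-\delta_{j,k})-\delta_{|i-j|,1}$, let $\boldsymbol e_1,\dots,\boldsymbol e_k$ be the unit vectors of $\mathbb{Z}^k$, and set $\boldsymbol e_0=\boldsymbol 0$. For $\boldsymbol L\in\mathbb{Z}^k$ put $\boldsymbol\ell=T^{-1}\boldsymbol L$, and define the $q$-supernomial coefficient $$\left[{\boldsymbol L\atop c}\right]=\sum_{\substack{j_1,\dots,j_k\ge 0\\ j_1+\cdots+j_k=c+\ell_k/2}} q^{\sum_{i=2}^{k} j_{i-1}(L_i+\cdots+L_k-j_i)}\prod_{i=1}^{k}\left[{L_i+j_{i+1}\atop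 j_i}\right]\qquad (j_{k+1}=0),$$ which is $0$ unless $c+\ell_k/2$ is a non-negative integer. With $N_j=n_j+\cdots+n_k$, consider $$f(x_1,\dots,x_k)=\sum_{n_1,\dots,n_k\in\mathbb{Z}}\frac{q^{N_1^2+\cdots+N_k^2+N_a+\cdots+N_k}\;x_1^{2N_1}x_2^{2N_1+2N_2}\cdots x_k^{2N_1+\cdots+2N_k}}{(x_1)_{n_1+1}(x_2)_{n_2+1}\cdots(x_k)_{n_k+1}},$$ where each summand is expanded as a formal Laurent series in non-negative powers of the $x_j$ times a monomial, and let $P(\boldsymbol M)$ denote the coefficient of $x_1^{M_1}\cdots x_k^{M_k}$ in $f$. Theorem. Let $\boldsymbol M\in\mathbb{Z}^k$ be such that $\boldsymbol L=T\boldsymbol M-\boldsymbol e_{a-1}+\boldsymbol e_k$ has non-negative entries, and let $b=k+1$ if $\ell_k+a+k$ is odd and $b=k+2$ if $\ell_k+a+k$ is even. Then only finitely many summands of $f$ contribute to $P(\boldsymbol M)$, only finitely many terms of the following sum are non-zero, and $$P(\boldsymbol M)=\sum_{j=-\infty}^{\infty}\left\{q^{j((2k+3)(2j+1)-2a)}\left[{\boldsymbol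 L\atop \frac{b-a}{2}+(2k+3)j}\right]-q^{(2j+1)((2k+3)j+a)}\left[{\boldsymbol L\atop \frac{b+a}{2}+(2k+3)j}\right]\right\}.$$ Consequently one has the polynomial Andrews–Gordon identity with $k$ finitization parameters, that is, the sum $$\sum_{n_1,\dots,n_k\in\mathbb{Z}}q^{N_1^2+\cdots+N_k^2+N_a+\cdots+N_k}\prod_{j=1}^{k}\left[{M_j+n_j-2\sum_{m=1}^{j}N_m\atop M_j-2\sum_{m=1}^{j}N_m}\right],$$ which has only finitely many non-zero terms, is equal to the right-hand side of the previous identity. -/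

import Mathlib

open scoped Matrix

namespace Supernomial

section General

/-- `(x)_n = (x; q)_n` for `n : ℤ`, i.e. `(x)_∞ / (x q^n)_∞`: the product
`(1 - x)(1 - x q) ⋯ (1 - x q^(n-1))` for `n ≥ 0`, and
`1 / ((1 - x q^(-1)) ⋯ (1 - x q^n))` for `n < 0`. -/
def qPoch {A : Type*} [Field A] (x q : A) : ℤ → A
  | Int.ofNat n => ∏ i ∈ Finset.range n, (1 - x * q ^ i)
  | Int.negSucc n => (∏ i ∈ Finset.range (n + 1), (1 - x * q ^ (-((i : ℤ) + 1))))⁻¹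

/-- The `q`-binomial coefficient with arbitrary integer top entry:
`(q^(L-a+1))_a / (q)_a` if `a ≥ 0`, and `0` otherwise. -/
def qBin {K : Type*} [Field K] (q : K) (L a : ℤ) : K :=
  if 0 ≤ a then qPoch (q ^ (L - a + 1)) q a / qPoch q q a else 0

/-- The Cartan-type matrix `T` of the tadpole graph with `N` nodes,
`T_{ij} = δ_{ij} (2 - δ_{jN}) - δ_{|i-j|,1}` (node `i` is the element `i - 1` of `Fin N`). -/
def tadpole (N : ℕ) : Matrix (Fin N) (Fin N) ℤ := fun i j =>
  (if i = j then 2 - (if (j : ℕ) + 1 = N then 1 else 0) else 0)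
    - (if (i : ℕ) + 1 = (j : ℕ) ∨ (j : ℕ) + 1 = (i : ℕ) then 1 else 0)

/-- The unit vector `e_n` of `ℤ^N`; it is zero unless `1 ≤ n ≤ N`. -/
def unitVec (N n : ℕ) : Fin N → ℤ := fun i => if (i : ℕ) + 1 = n then 1 else 0

/-- `ℓ_N`, the last entry of the vector `ℓ = T⁻¹ L`.
(`T` has determinant `1`, so this is the inverse over `ℤ`; its entries are `min {i, j}`.) -/
noncomputable def ellLast {N : ℕ} (L : Fin N → ℤ) : ℤ :=
  unitVec N N ⬝ᵥ ((tadpole N)⁻¹ *ᵥ L)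

/-- The entry after the `i`-th one in `j = (j_1, …, j_N)`, with `j_{N+1} = 0`. -/
def nextEntry {N : ℕ} (j : Fin N → ℕ) (i : Fin N) : ℕ :=
  if h : (i : ℕ) + 1 < N then j ⟨(i : ℕ) + 1, h⟩ else 0

/-- The summand of the `q`-supernomial coefficient that belongs to `j = (j_1, …, j_N)`:
`q^(∑_{k=2}^N j_{k-1} (L_k + ⋯ + L_N - j_k)) ∏_{k=1}^N [L_k + j_{k+1}; j_k]`.
(The term `i = N` of the exponent below vanishes.) -/
noncomputable def supernomialTerm {K : Type*} [Field K] (q : K) {N : ℕ} (L : Fin N → ℤ)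
    (j : Fin N → ℕ) : K :=
  q ^ (∑ i, (j i : ℤ) * ((∑ m ∈ Finset.Ioi i, L m) - (nextEntry j i : ℤ)))
    * ∏ i, qBin q (L i + (nextEntry j i : ℤ)) (j i : ℤ)

/-- The `q`-supernomial coefficient `[L; a]`: the sum of the above summands over all
`j_1, …, j_N ≥ 0` with `j_1 + ⋯ + j_N = a + ℓ_N / 2` (a finite set, which is empty unless
`a + ℓ_N / 2` is a non-negative integer). -/
noncomputable def qSupernomial {K : Type*} [Field K] (q : K) {N : ℕ} (L : Fin N → ℤ)
    (a : ℚ) : K :=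
  ∑ᶠ (j : Fin N → ℕ) (_ : ((∑ i, j i : ℕ) : ℚ) = a + (ellLast L : ℚ) / 2),
    supernomialTerm q L j

end General

section AndrewsGordon

/-- `N_j = n_j + ⋯ + n_k`. -/
def bigN {k : ℕ} (n : Fin k → ℤ) (j : Fin k) : ℤ := ∑ i ∈ Finset.Ici j, n i

/-- The exponent `2 N_1 + ⋯ + 2 N_j` of `x_j`. -/
def xExponent {k : ℕ} (n : Fin k → ℤ) (j : Fin k) : ℤ := 2 * ∑ m ∈ Finset.Iic j, bigN n m

/-- `N_1^2 + ⋯ + N_k^2 + N_a + ⋯ + N_k`. -/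
def qExponent {k : ℕ} (a : ℕ) (n : Fin k → ℤ) : ℤ :=
  (∑ i, bigN n i ^ 2) + ∑ i : Fin k with a ≤ i.val + 1, bigN n i

/-- The product `g_1(x_1) ⋯ g_k(x_k)` of one-variable formal Laurent series in distinct
variables. A formal series in `x_1, …, x_k`, infinite in all directions, is given by the family
of its coefficients, indexed by the exponents `M ∈ ℤ^k`. -/
noncomputable def separateProd {K : Type*} [Field K] {k : ℕ} (g : Fin k → LaurentSeries K) :
    (Fin k → ℤ) → K :=
  fun M => ∏ j, (g j).coeff (M j)

/-- The Laurent series `x^e / (x)_{n+1}` in one variable `x`, in the field `K((x))`. -/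
noncomputable def oneVariableFactor {K : Type*} [Field K] (q : K) (e n : ℤ) : LaurentSeries K :=
  HahnSeries.single e 1 / qPoch (HahnSeries.single (1 : ℤ) (1 : K)) (HahnSeries.C q) (n + 1)

/-- The summand
`q^(N_1^2 + ⋯ + N_k^2 + N_a + ⋯ + N_k) x_1^(2N_1) x_2^(2N_1+2N_2) ⋯ x_k^(2N_1+⋯+2N_k)
  / ((x_1)_{n_1+1} ⋯ (x_k)_{n_k+1})`
of `f(x_1, …, x_k)`, as a formal series in `x_1, …, x_k`. -/
noncomputable def fTerm {K : Type*} [Field K] (q : K) {k : ℕ} (a : ℕ) (n : Fin k → ℤ) :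
    (Fin k → ℤ) → K :=
  fun M => q ^ qExponent a n *
    separateProd (fun j => oneVariableFactor q (xExponent n j) (n j)) M

/-- The coefficient `P(M)` of `x_1^(M_1) ⋯ x_k^(M_k)` in
`f(x_1, …, x_k) = ∑_{n ∈ ℤ^k} fTerm q a n`. -/
noncomputable def coeffP {K : Type*} [Field K] (q : K) {k : ℕ} (a : ℕ) (M : Fin k → ℤ) : K :=
  ∑ᶠ n : Fin k → ℤ, fTerm q a n M

/-- The summand of the fermionic sum:
`q^(N_1^2 + ⋯ + N_k^2 + N_a + ⋯ + N_k)
  ∏_j [M_j + n_j - 2(N_1 + ⋯ + N_j); M_j - 2(N_1 + ⋯ + N_j)]`. -/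
noncomputable def fermionicTerm {K : Type*} [Field K] (q : K) {k : ℕ} (a : ℕ) (M n : Fin k → ℤ) :
    K :=
  q ^ qExponent a n * ∏ j, qBin q (M j + n j - xExponent n j) (M j - xExponent n j)

/-- `L = T M - e_{a-1} + e_k`. -/
def vecL {k : ℕ} (a : ℕ) (M : Fin k → ℤ) : Fin k → ℤ :=
  tadpole k *ᵥ M - unitVec k (a - 1) + unitVec k k

/-- `b = k + 1` if `ℓ_k + a + k` is odd and `b = k + 2` if it is even. -/
noncomputable def parityB (k a : ℕ) (L : Fin k → ℤ) : ℕ :=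
  if Odd (ellLast L + a + k) then k + 1 else k + 2

/-- The summand of the bosonic sum:
`q^(j((2k+3)(2j+1)-2a)) [L; (b-a)/2 + (2k+3)j] - q^((2j+1)((2k+3)j+a)) [L; (b+a)/2 + (2k+3)j]`. -/
noncomputable def bosonicTerm {K : Type*} [Field K] (q : K) {k : ℕ} (a b : ℕ) (L : Fin k → ℤ)
    (j : ℤ) : K :=
  q ^ (j * ((2 * k + 3) * (2 * j + 1) - 2 * a))
      * qSupernomial q L (((b : ℚ) - a) / 2 + (2 * k + 3) * j)
    - q ^ ((2 * j + 1) * ((2 * k + 3) * j + a))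
      * qSupernomial q L (((b : ℚ) + a) / 2 + (2 * k + 3) * j)

end AndrewsGordon

end Supernomial

/-! Both sides, as functions of L, obey the same recurrences and have the same initial values.

The coefficient of `x^m` in `1/(x)_{n+1}` is `[n+m; m]` for every integer `n`, so P(M) is the
fermionic sum term by term (`fTerm_eq_fermionicTerm`). Write this sum as G(L), with M = T⁻¹(L +
e_{a-1} - e_k), and let e_{k+1} act as e_k. Pascal's rule in one factor and a shift of one n_A give
G(L + 2e_A) = G(L + e_{A-1} + e_{A+1}) + q^(A + ∑ min(i,A) L_i) G(L)
(`fermionic_quadratic_recurrence`).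

Supernomials with k+1 entries satisfy the same recurrence for 1 ≤ A ≤ k
(`supernomial_quadratic_recurrence`), with e_{k+1} now an honest entry. In the bosonic sum it can be
replaced by e_k: the extra terms of the two halves cancel under a reflection of the summation index,
and b switches between k+1 and k+2 (`bosonicSum_fold_even`, `bosonicSum_fold_odd`). The cancellation
rests on the symmetry [L; c] = [L; -c] (`supernomial_neg`), proved for nonnegative L only.

A vector such as e_1 + e_2 has no entry that can be lowered by two and stay nonnegative, so the
quadratic recurrences are combined, passing through entries -1, into mixed ones for L + e_A + e_B
(`mixed_recurrence`). All vectors in these are nonnegative, and they determine a function from its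
values at 0, e_1, …, e_k (`eq_zero_of_mixed_recurrence`). At e_B both sums are 1 or 0 according to
whether B + a ≥ k + 1 (`fermionic_single`, `bosonic_single`). -/

namespace Supernomial

/-! ### q-binomial coefficients with integer top entry: the two Pascal rules and vanishing. -/

section QBinomial

variable {K : Type*} [Field K] {q : K}

theorem qPoch_natCast (x : K) (n : ℕ) :
    qPoch x q (n : ℤ) = ∏ i ∈ Finset.range n, (1 - x * q ^ i) := rfl

theorem qPoch_self_ne_zero (hq1 : ∀ n : ℕ, 0 < n → q ^ n ≠ 1) (n : ℕ) :
    qPoch q q (n : ℤ) ≠ 0 := by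
  rw [qPoch_natCast]
  refine Finset.prod_ne_zero_iff.2 fun i _ => ?_
  rw [← pow_succ', sub_ne_zero]
  exact (hq1 (i + 1) i.succ_pos).symm

theorem qBin_of_neg (L : ℤ) {m : ℤ} (hm : m < 0) : qBin q L m = 0 := by
  simp [qBin, not_le.2 hm]

@[simp]
theorem qBin_zero_right (L : ℤ) : qBin q L 0 = 1 := by
  have h : ∀ x : K, qPoch x q 0 = 1 := fun x => by
    simpa using qPoch_natCast (q := q) x 0
  simp [qBin, h]

theorem qBin_natCast (L : ℤ) (n : ℕ) :
    qBin q L n = qPoch (q ^ (L - n + 1)) q n / qPoch q q n := by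
  simp [qBin]

theorem qPoch_succ (x : K) (n : ℕ) :
    qPoch x q ((n + 1 : ℕ) : ℤ) = qPoch x q (n : ℤ) * (1 - x * q ^ n) := by
  simp only [qPoch_natCast, Finset.prod_range_succ]

theorem qPoch_succ' (x : K) (n : ℕ) :
    qPoch x q ((n + 1 : ℕ) : ℤ) = (1 - x) * qPoch (x * q) q (n : ℤ) := by
  simp only [qPoch_natCast, Finset.prod_range_succ', pow_zero, mul_one, pow_succ']
  rw [mul_comm]
  simp only [mul_assoc]

theorem qBin_pascal (hq0 : q ≠ 0) (hq1 : ∀ n : ℕ, 0 < n → q ^ n ≠ 1) (L m : ℤ) :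
    qBin q (L + 1) m = q ^ m * qBin q L m + qBin q L (m - 1) := by
  rcases lt_trichotomy m 0 with hm | rfl | hm
  · rw [qBin_of_neg _ hm, qBin_of_neg _ hm, qBin_of_neg _ (by omega)]; simp
  · rw [qBin_of_neg _ (by omega : (0 : ℤ) - 1 < 0)]; simp
  · obtain ⟨n, rfl⟩ : ∃ n : ℕ, m = ((n + 1 : ℕ) : ℤ) := ⟨(m - 1).toNat, by omega⟩
    have e : ((n + 1 : ℕ) : ℤ) - 1 = (n : ℤ) := by push_cast; ring
    rw [e, qBin_natCast, qBin_natCast, qBin_natCast]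
    have h1 := qPoch_self_ne_zero hq1 n
    have h2 := qPoch_self_ne_zero hq1 (n + 1)
    have e1 : L + 1 - ((n + 1 : ℕ) : ℤ) + 1 = L - n + 1 := by push_cast; ring
    have e2 : L - ((n + 1 : ℕ) : ℤ) + 1 = L - n := by push_cast; ring
    rw [e1, e2, qPoch_succ (q ^ (L - (n : ℤ) + 1)), qPoch_succ' (q ^ (L - (n : ℤ)))]
    have e3 : q ^ (L - (n : ℤ)) * q = q ^ (L - (n : ℤ) + 1) := by rw [zpow_add_one₀ hq0]
    rw [e3]
    have e4 : qPoch q q ((n + 1 : ℕ) : ℤ) = qPoch q q (n : ℤ) * (1 - q * q ^ n) := qPoch_succ _ _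
    rw [e4] at h2 ⊢
    have h3 := right_ne_zero_of_mul h2
    have e5 : q ^ (L - (n : ℤ) + 1) = q ^ (L - (n : ℤ)) * q := e3.symm
    have e6 : q ^ ((n + 1 : ℕ) : ℤ) = q * q ^ n := by rw [zpow_natCast, pow_succ']
    rw [e6, e5]
    generalize qPoch q q (n : ℤ) = d at *
    generalize qPoch (q ^ (L - (n : ℤ)) * q) q n = p
    generalize q ^ (L - (n : ℤ)) = w
    generalize q ^ n = u at *
    field_simp
    ring

theorem qBin_pascal' (hq0 : q ≠ 0) (hq1 : ∀ n : ℕ, 0 < n → q ^ n ≠ 1) (L m : ℤ) :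
    qBin q (L + 1) m = qBin q L m + q ^ (L + 1 - m) * qBin q L (m - 1) := by
  rcases lt_trichotomy m 0 with hm | rfl | hm
  · rw [qBin_of_neg _ hm, qBin_of_neg _ hm, qBin_of_neg _ (by omega)]; simp
  · rw [qBin_of_neg _ (by omega : (0 : ℤ) - 1 < 0)]; simp
  · obtain ⟨n, rfl⟩ : ∃ n : ℕ, m = ((n + 1 : ℕ) : ℤ) := ⟨(m - 1).toNat, by omega⟩
    have e : ((n + 1 : ℕ) : ℤ) - 1 = (n : ℤ) := by push_cast; ring
    rw [e, qBin_natCast, qBin_natCast, qBin_natCast]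
    have h1 := qPoch_self_ne_zero hq1 n
    have h2 := qPoch_self_ne_zero hq1 (n + 1)
    have e1 : L + 1 - ((n + 1 : ℕ) : ℤ) + 1 = L - n + 1 := by push_cast; ring
    have e2 : L - ((n + 1 : ℕ) : ℤ) + 1 = L - n := by push_cast; ring
    have e7 : L + 1 - ((n + 1 : ℕ) : ℤ) = L - n := by push_cast; ring
    rw [e1, e2, e7, qPoch_succ (q ^ (L - (n : ℤ) + 1)), qPoch_succ' (q ^ (L - (n : ℤ)))]
    have e3 : q ^ (L - (n : ℤ)) * q = q ^ (L - (n : ℤ) + 1) := by rw [zpow_add_one₀ hq0]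
    rw [e3]
    have e4 : qPoch q q ((n + 1 : ℕ) : ℤ) = qPoch q q (n : ℤ) * (1 - q * q ^ n) := qPoch_succ _ _
    rw [e4] at h2 ⊢
    have h3 := right_ne_zero_of_mul h2
    have e5 : q ^ (L - (n : ℤ) + 1) = q ^ (L - (n : ℤ)) * q := e3.symm
    rw [e5]
    generalize qPoch q q (n : ℤ) = d at *
    generalize qPoch (q ^ (L - (n : ℤ)) * q) q n = p
    generalize q ^ (L - (n : ℤ)) = w
    generalize q ^ n = u at *
    field_simp
    ring

theorem qBin_eq_zero (hq0 : q ≠ 0) {L m : ℤ} (h0 : 0 ≤ L) (h : L < m) : qBin q L m = 0 := by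
  obtain ⟨n, rfl⟩ : ∃ n : ℕ, m = (n : ℤ) := ⟨m.toNat, by omega⟩
  rw [qBin_natCast, qPoch_natCast, Finset.prod_eq_zero (i := ((n : ℤ) - 1 - L).toNat)]
  · simp
  · simp; omega
  · rw [← zpow_natCast, ← zpow_add₀ hq0, sub_eq_zero]
    rw [Int.toNat_of_nonneg (by omega)]
    rw [show L - (n : ℤ) + 1 + ((n : ℤ) - 1 - L) = 0 by ring, zpow_zero]

theorem qBin_self (hq1 : ∀ n : ℕ, 0 < n → q ^ n ≠ 1) {L : ℤ} (h0 : 0 ≤ L) :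
    qBin q L L = 1 := by
  obtain ⟨n, rfl⟩ : ∃ n : ℕ, L = (n : ℤ) := ⟨L.toNat, by omega⟩
  rw [qBin_natCast, sub_self, zero_add, zpow_one, div_self (qPoch_self_ne_zero hq1 n)]

theorem qBin_zero_left (hq0 : q ≠ 0) (m : ℤ) : qBin q 0 m = if m = 0 then 1 else 0 := by
  rcases lt_trichotomy m 0 with hm | rfl | hm
  · rw [qBin_of_neg _ hm, if_neg hm.ne]
  · simp
  · rw [qBin_eq_zero hq0 le_rfl hm, if_neg hm.ne']

end QBinomial

/-! ### Laurent expansion of `1/(x)_{n+1}`, and P(M) as a fermionic sum. -/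

section Laurent

variable {K : Type*} [Field K] {q : K}

theorem qPoch_add_one {A : Type*} [Field A] {q : A} (x : A) (n : ℤ)
    (h : ∀ m : ℤ, 1 - x * q ^ m ≠ 0) :
    qPoch x q (n + 1) = qPoch x q n * (1 - x * q ^ n) := by
  obtain ⟨n, rfl⟩ | ⟨n, rfl⟩ : (∃ m : ℕ, n = m) ∨ ∃ m : ℕ, n = Int.negSucc m := by
    cases n with
    | ofNat n => exact Or.inl ⟨n, rfl⟩
    | negSucc n => exact Or.inr ⟨n, rfl⟩
  · have := qPoch_succ (q := q) x n
    simpa using this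
  · cases n with
    | zero =>
      have h1 : qPoch x q (Int.negSucc 0 + 1) = 1 := by
        exact Finset.prod_range_zero _
      have h2 := h (-1)
      rw [h1]
      simp only [qPoch]
      simp only [zero_add, Finset.prod_range_one, Int.negSucc_eq, Nat.cast_zero]
      exact (inv_mul_cancel₀ h2).symm
    | succ n =>
      have h1 : Int.negSucc (n + 1) + 1 = Int.negSucc n := by
        simp only [Int.negSucc_eq]; push_cast; ring
      rw [h1]
      simp only [qPoch]
      rw [Finset.prod_range_succ _ (n + 1), mul_inv]
      have e : (-(((n + 1 : ℕ) : ℤ) + 1)) = Int.negSucc (n + 1) := by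
        simp only [Int.negSucc_eq]
      rw [e, mul_assoc, inv_mul_cancel₀ (h _), mul_one]

/-- The series `∑_{m ≥ 0} [n + m; m] x^m`. -/
noncomputable def binomialSeries (q : K) (n : ℤ) : LaurentSeries K :=
  HahnSeries.ofPowerSeries ℤ K (PowerSeries.mk fun m => qBin q (n + m) m)

theorem binomialSeries_coeff (n m : ℤ) : (binomialSeries q n).coeff m = qBin q (n + m) m := by
  rcases lt_or_ge m 0 with hm | hm
  · rw [qBin_of_neg _ hm, binomialSeries, HahnSeries.ofPowerSeries_apply]
    refine HahnSeries.embDomain_of_notMem_range ?_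
    rintro ⟨i, hi⟩
    simp at hi
    omega
  · obtain ⟨n, rfl⟩ := Int.eq_ofNat_of_zero_le hm
    rw [binomialSeries, LaurentSeries.coeff_coe_powerSeries]
    simp

theorem binomialSeries_mul (hq0 : q ≠ 0) (hq1 : ∀ n : ℕ, 0 < n → q ^ n ≠ 1) (n : ℤ) :
    binomialSeries q n * (1 - HahnSeries.single (1 : ℤ) (1 : K) * (HahnSeries.C q) ^ n)
      = binomialSeries q (n - 1) := by
  have hC : (HahnSeries.C q : LaurentSeries K) ^ n = HahnSeries.C (q ^ n) :=
    (map_zpow₀ (HahnSeries.C : K →+* LaurentSeries K) q n).symm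
  rw [hC, HahnSeries.C_apply, HahnSeries.single_mul_single, add_zero, one_mul]
  ext m
  rw [mul_sub, mul_one, HahnSeries.coeff_sub]
  obtain ⟨m', rfl⟩ : ∃ m', m = m' + 1 := ⟨m - 1, by ring⟩
  rw [HahnSeries.coeff_mul_single_add, binomialSeries_coeff, binomialSeries_coeff,
    binomialSeries_coeff]
  have := qBin_pascal' hq0 hq1 (n + m') (m' + 1)
  rw [show n + (m' + 1) = n + m' + 1 by ring, this]
  rw [show n - 1 + (m' + 1) = n + m' by ring, show n + m' + 1 - (m' + 1) = n by ring,
    add_sub_cancel_right]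
  ring

theorem binomialSeries_neg_one (hq0 : q ≠ 0) : binomialSeries q (-1) = 1 := by
  ext m
  rw [binomialSeries_coeff, HahnSeries.coeff_one]
  rcases lt_trichotomy m 0 with hm | rfl | hm
  · rw [qBin_of_neg _ hm, if_neg hm.ne]
  · simp
  · rw [qBin_eq_zero hq0 (by omega) (by omega), if_neg hm.ne']

theorem one_sub_single_ne_zero (n : ℤ) :
    (1 : LaurentSeries K) - HahnSeries.single (1 : ℤ) (1 : K) * (HahnSeries.C q) ^ n ≠ 0 := by
  intro h
  have hC : (HahnSeries.C q : LaurentSeries K) ^ n = HahnSeries.C (q ^ n) :=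
    (map_zpow₀ (HahnSeries.C : K →+* LaurentSeries K) q n).symm
  rw [hC, HahnSeries.C_apply, HahnSeries.single_mul_single, add_zero, one_mul] at h
  have := congrArg (fun s => HahnSeries.coeff s 0) h
  simp at this

/-- At `n = -1` both factors are 1. The second Pascal rule says that multiplication by `1 - x q^n`
lowers `n` by one in the series, so induction runs both ways from -1. -/
theorem binomialSeries_mul_qPoch (hq0 : q ≠ 0) (hq1 : ∀ n : ℕ, 0 < n → q ^ n ≠ 1) (n : ℤ) :
    binomialSeries q n
      * qPoch (HahnSeries.single (1 : ℤ) (1 : K)) (HahnSeries.C q) (n + 1) = 1 := by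
  induction n using Int.inductionOn' (b := -1) with
  | zero =>
    rw [binomialSeries_neg_one hq0, one_mul]
    exact Finset.prod_range_zero _
  | succ n _ ih =>
    rw [qPoch_add_one _ _ one_sub_single_ne_zero, mul_comm (qPoch _ _ _), ← mul_assoc,
      binomialSeries_mul hq0 hq1, add_sub_cancel_right, ih]
  | pred n _ ih =>
    rw [qPoch_add_one _ _ one_sub_single_ne_zero, mul_comm (qPoch _ _ _), ← mul_assoc,
      binomialSeries_mul hq0 hq1] at ih
    rw [sub_add_cancel, ih]

theorem oneVariableFactor_coeff (hq0 : q ≠ 0) (hq1 : ∀ n : ℕ, 0 < n → q ^ n ≠ 1) (e n m : ℤ) :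
    (oneVariableFactor q e n).coeff m = qBin q (m + n - e) (m - e) := by
  have h := binomialSeries_mul_qPoch hq0 hq1 n
  have : oneVariableFactor q e n = binomialSeries q n * HahnSeries.single e 1 := by
    rw [oneVariableFactor, div_eq_iff (right_ne_zero_of_mul_eq_one h), mul_right_comm, h, one_mul]
  rw [this]
  have := HahnSeries.coeff_mul_single_add (x := binomialSeries q n) (r := (1 : K)) (a := m - e)
    (b := e)
  rw [sub_add_cancel] at this
  rw [this, binomialSeries_coeff, mul_one]
  congr 1
  ring

theorem fTerm_eq_fermionicTerm (hq0 : q ≠ 0) (hq1 : ∀ n : ℕ, 0 < n → q ^ n ≠ 1) {k : ℕ} (a : ℕ)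
    (M n : Fin k → ℤ) : fTerm q a n M = fermionicTerm q a M n := by
  simp only [fTerm, fermionicTerm, separateProd, oneVariableFactor_coeff hq0 hq1]

end Laurent

/-! ### Supernomials as iterated sums: recurrences, degree bound and symmetry. -/

section PartialSums

variable {K : Type*} [Field K] {q : K}

/-- The sum over `j_1, …, j_n ≥ 0` with `j_1 + ⋯ + j_n = J` that defines the supernomial
coefficient, with `L_1, …, L_{n-1}` taken from the sequence `L` and with `x` in place of `L_n`,
up to the factor `q^(J x)`. It is defined by recursion on `n`, the summation variable
being `j_n`. -/
noncomputable def partialSum (q : K) (L : ℕ → ℤ) : ℕ → ℤ → ℤ → K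
  | 0, _, J => if J = 0 then 1 else 0
  | n + 1, x, J => ∑ᶠ j : ℤ,
      q ^ (L n * (J - j) - j * x) * qBin q x j * partialSum q L n (L n + j) (J - j)

theorem partialSum_zero (L : ℕ → ℤ) (x J : ℤ) :
    partialSum q L 0 x J = if J = 0 then 1 else 0 := rfl

theorem partialSum_succ (L : ℕ → ℤ) (n : ℕ) (x J : ℤ) :
    partialSum q L (n + 1) x J = ∑ᶠ j : ℤ,
      q ^ (L n * (J - j) - j * x) * qBin q x j * partialSum q L n (L n + j) (J - j) := rfl

theorem partialSum_of_neg (L : ℕ → ℤ) (n : ℕ) (x : ℤ) {J : ℤ} (hJ : J < 0) :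
    partialSum q L n x J = 0 := by
  induction n generalizing x J with
  | zero => rw [partialSum_zero, if_neg hJ.ne]
  | succ n ih =>
    rw [partialSum_succ, ← finsum_zero (α := ℤ)]
    refine finsum_congr fun j => ?_
    rcases lt_or_ge j 0 with hj | hj
    · rw [qBin_of_neg _ hj]; simp
    · rw [ih _ (by omega)]; simp

theorem partialSum_congr {L L' : ℕ → ℤ} {n : ℕ} (h : ∀ i < n, L i = L' i) (x J : ℤ) :
    partialSum q L n x J = partialSum q L' n x J := by
  induction n generalizing x J with
  | zero => rfl
  | succ n ih =>
    rw [partialSum_succ, partialSum_succ, h n n.lt_succ_self]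
    exact finsum_congr fun j => by rw [ih fun i hi => h i (hi.trans n.lt_succ_self)]

/-- Only 0 ≤ j ≤ J contributes. The exponent and the inner argument are arbitrary because Pascal's
rules alter both. -/
theorem finite_support_summand (L : ℕ → ℤ) (n : ℕ) (x J : ℤ) (c y : ℤ → ℤ) :
    (Function.support fun j : ℤ =>
      q ^ c j * qBin q x j * partialSum q L n (y j) (J - j)).Finite := by
  refine (Set.finite_Icc 0 J).subset fun j hj => ?_
  by_contra h
  refine hj ?_
  rcases lt_or_ge j 0 with hj | hj
  · simp only [qBin_of_neg _ hj]; simp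
  · simp only [partialSum_of_neg L n _ (show J - j < 0 by simp at h; omega)]; simp

theorem finsum_sub_right {G : Type*} [AddGroup G] (f : G → K) (g : G) :
    ∑ᶠ x, f (x - g) = ∑ᶠ x, f x :=
  finsum_comp_equiv (Equiv.subRight g)

theorem finite_support_const_mul {ι : Type*} {f : ι → K} (c : K)
    (hf : (Function.support f).Finite) : (Function.support fun j => c * f j).Finite :=
  hf.subset fun _ hj => right_ne_zero_of_mul hj

theorem finite_support_sub_right {G : Type*} [AddGroup G] {f : G → K} (g : G)
    (hf : (Function.support f).Finite) : (Function.support fun x => f (x - g)).Finite :=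
  hf.preimage (f := fun x => x - g) (sub_left_injective.injOn)

/-- The first Pascal rule in the outermost binomial: the part `q^j [x; j]` reproduces the sum at
`x`. -/
theorem partialSum_succ_add_one_sub (hq0 : q ≠ 0) (hq1 : ∀ n : ℕ, 0 < n → q ^ n ≠ 1)
    (L : ℕ → ℤ) (n : ℕ) (x J : ℤ) :
    partialSum q L (n + 1) (x + 1) (J + 1) - partialSum q L (n + 1) x (J + 1) = ∑ᶠ j : ℤ,
      q ^ (L n * (J - j) - (j + 1) * (x + 1)) * qBin q x j
        * partialSum q L n (L n + j + 1) (J - j) := by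
  have hf := finite_support_summand (q := q) L n x J
    (fun j => L n * (J - j) - (j + 1) * (x + 1)) (fun j => L n + j + 1)
  rw [← finsum_sub_right _ (1 : ℤ), sub_eq_iff_eq_add', partialSum_succ, partialSum_succ,
    ← finsum_add_distrib (finite_support_summand L n _ _ _ _) (finite_support_sub_right 1 hf)]
  refine finsum_congr fun j => ?_
  rw [qBin_pascal hq0 hq1]
  have e1 : q ^ (L n * (J + 1 - j) - j * x) = q ^ (L n * (J + 1 - j) - j * (x + 1)) * q ^ j := by
    rw [← zpow_add₀ hq0]; congr 1; ring
  rw [e1, show L n * (J - (j - 1)) - (j - 1 + 1) * (x + 1) = L n * (J + 1 - j) - j * (x + 1) by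
    ring, show L n + (j - 1) + 1 = L n + j by ring, show J - (j - 1) = J + 1 - j by ring]
  ring

/-- The second Pascal rule in the same place. Comparing the two expansions yields
`partialSum_recurrence`. -/
theorem partialSum_succ_add_one (hq0 : q ≠ 0) (hq1 : ∀ n : ℕ, 0 < n → q ^ n ≠ 1)
    (L : ℕ → ℤ) (n : ℕ) (x J : ℤ) :
    partialSum q L (n + 1) (x + 1) J =
      ∑ᶠ j : ℤ, q ^ (L n * (J - j) - j * (x + 1)) * qBin q x j
        * partialSum q L n (L n + j) (J - j)
      + ∑ᶠ j : ℤ, q ^ (L n * (J - j) - j * (x + 1) - (L n + j + 1)) * qBin q x j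
        * partialSum q L n (L n + j + 1) (J - 1 - j) := by
  have hf := finite_support_summand (q := q) L n x (J - 1)
    (fun j => L n * (J - j) - j * (x + 1) - (L n + j + 1)) (fun j => L n + j + 1)
  rw [← finsum_sub_right (fun j : ℤ => q ^ (L n * (J - j) - j * (x + 1) - (L n + j + 1))
      * qBin q x j * partialSum q L n (L n + j + 1) (J - 1 - j)) 1, partialSum_succ,
    ← finsum_add_distrib (finite_support_summand L n _ _ _ _) (finite_support_sub_right 1 hf)]
  refine finsum_congr fun j => ?_
  rw [qBin_pascal' hq0 hq1]
  have e1 : q ^ (L n * (J - (j - 1)) - (j - 1) * (x + 1) - (L n + (j - 1) + 1))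
      = q ^ (L n * (J - j) - j * (x + 1)) * q ^ (x + 1 - j) := by
    rw [← zpow_add₀ hq0]; congr 1; ring
  rw [e1, show L n + (j - 1) + 1 = L n + j by ring, show J - 1 - (j - 1) = J - j by ring]
  ring

/-- For `n = 1` this says that the two Pascal rules agree. It is the basic relation in `x`: both the
symmetry and the quadratic recurrence come from it. -/
theorem partialSum_recurrence (hq0 : q ≠ 0) (hq1 : ∀ n : ℕ, 0 < n → q ^ n ≠ 1)
    (L : ℕ → ℤ) (n : ℕ) (x J : ℤ) :
    q ^ (x + 1) * (partialSum q L n (x + 1) (J + 1) - partialSum q L n x (J + 1))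
      = partialSum q L n (x + 1) J
        - q ^ (n + ∑ i ∈ Finset.range n, i * L i - 2 * J) * partialSum q L n x (J - n) := by
  induction n generalizing x J with
  | zero =>
    simp only [partialSum_zero, Finset.range_zero, Finset.sum_empty]
    by_cases h : J = 0 <;> simp [h]
  | succ n ih =>
    set s := ∑ i ∈ Finset.range n, (i : ℤ) * L i with hs
    have hf := finite_support_summand (q := q) L n x (J - 1)
      (fun j => L n * (J - j) - j * (x + 1) - (L n + j + 1)) (fun j => L n + j + 1)
    have hg := finite_support_summand (q := q) L n x J
      (fun j => L n * (J - j) - j * (x + 1)) (fun j => L n + j)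
    have hh := finite_support_summand (q := q) L n x (J - (n + 1 : ℕ))
      (fun j => L n * (J - (n + 1 : ℕ) - j) - j * x) (fun j => L n + j)
    rw [partialSum_succ_add_one_sub hq0 hq1, partialSum_succ_add_one hq0 hq1, eq_sub_iff_add_eq,
      ← finsum_add_distrib hg hf, partialSum_succ, mul_finsum _ _, mul_finsum _ _,
      ← finsum_add_distrib]
    · refine finsum_congr fun j => ?_
      -- This instance involves `partialSum` at the arguments `L n + j` and `L n + j + 1`, exactly
      -- those which the two Pascal expansions produce.
      have h := ih (L n + j) (J - 1 - j)
      rw [show J - 1 - j + 1 = J - j by ring] at h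
      have e0 : q ^ (x + 1) * q ^ (L n * (J - j) - (j + 1) * (x + 1))
          = q ^ (L n * (J - j) - j * (x + 1)) := by
        rw [← zpow_add₀ hq0]; congr 1; ring
      have e1 : q ^ (L n * (J - j) - j * (x + 1))
          = q ^ (L n * (J - j) - j * (x + 1) - (L n + j + 1)) * q ^ (L n + j + 1) := by
        rw [← zpow_add₀ hq0]; congr 1; ring
      have e2 : q ^ (((n + 1 : ℕ) : ℤ) + ∑ i ∈ Finset.range (n + 1), (i : ℤ) * L i - 2 * J)
            * q ^ (L n * (J - (n + 1 : ℕ) - j) - j * x)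
          = q ^ (L n * (J - j) - j * (x + 1) - (L n + j + 1))
            * q ^ (n + s - 2 * (J - 1 - j)) := by
        rw [← zpow_add₀ hq0, ← zpow_add₀ hq0, Finset.sum_range_succ, ← hs]
        congr 1; push_cast; ring
      rw [show J - ((n + 1 : ℕ) : ℤ) - j = J - 1 - j - n by push_cast; ring] at *
      rw [← mul_assoc, ← mul_assoc, ← mul_assoc, ← mul_assoc, e0, e2, e1]
      linear_combination q ^ (L n * (J - j) - j * (x + 1) - (L n + j + 1)) * qBin q x j * h
    · exact finite_support_const_mul _ (finite_support_summand (q := q) L n x J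
        (fun j => L n * (J - j) - (j + 1) * (x + 1)) (fun j => L n + j + 1))
    · exact finite_support_const_mul _ hh

/-- Trades a unit in the entry just below `x` for a unit in `x`; the primed version is the same
after `partialSum_recurrence`. -/
theorem partialSum_add_single_pred (hq0 : q ≠ 0) (hq1 : ∀ n : ℕ, 0 < n → q ^ n ≠ 1)
    (L : ℕ → ℤ) (n : ℕ) (y J : ℤ) :
    partialSum q (L + Pi.single n 1) (n + 1) y J
      = q ^ (y + J + 1) * (partialSum q L (n + 1) (y + 1) (J + 1)
        - partialSum q L (n + 1) y (J + 1)) := by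
  rw [partialSum_succ_add_one_sub hq0 hq1, partialSum_succ, mul_finsum]
  refine finsum_congr fun j => ?_
  have e1 : q ^ (y + J + 1) * q ^ (L n * (J - j) - (j + 1) * (y + 1))
      = q ^ ((L n + 1) * (J - j) - j * y) := by
    rw [← zpow_add₀ hq0]; congr 1; ring
  have hc := partialSum_congr (q := q) (L := L + Pi.single n 1) (L' := L) (n := n)
    (fun i hi => by simp [hi.ne]) (L n + j + 1) (J - j)
  have e2 : (L + Pi.single n 1 : ℕ → ℤ) n = L n + 1 := by simp
  rw [e2, show L n + 1 + j = L n + j + 1 by ring, hc, ← e1]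
  ring

theorem partialSum_add_single_pred' (hq0 : q ≠ 0) (hq1 : ∀ n : ℕ, 0 < n → q ^ n ≠ 1)
    (L : ℕ → ℤ) (n : ℕ) (y J : ℤ) :
    partialSum q (L + Pi.single n 1) (n + 1) y J
      = q ^ J * partialSum q L (n + 1) (y + 1) J
        - q ^ ((n + 1 : ℕ) + ∑ i ∈ Finset.range (n + 1), i * L i - J)
          * partialSum q L (n + 1) y (J - (n + 1 : ℕ)) := by
  rw [partialSum_add_single_pred hq0 hq1]
  have h := partialSum_recurrence hq0 hq1 L (n + 1) y J
  have e1 : q ^ (y + J + 1) = q ^ J * q ^ (y + 1) := by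
    rw [← zpow_add₀ hq0]; congr 1; ring
  have e2 : q ^ (((n + 1 : ℕ) : ℤ) + ∑ i ∈ Finset.range (n + 1), (i : ℤ) * L i - J)
      = q ^ J * q ^ (((n + 1 : ℕ) : ℤ) + ∑ i ∈ Finset.range (n + 1), (i : ℤ) * L i - 2 * J) := by
    rw [← zpow_add₀ hq0]; congr 1; ring
  rw [e1, e2]
  linear_combination q ^ J * h

/-- The quadratic recurrence for A = n + 1 when the only layer above L_A is that of `x`, so that
adding e_{A+1} means `x + 1`. The second Pascal rule in `x` splits the e_{A-1} term in two; the
trading lemmas, applied to these parts, match them with the other terms for each `j`. -/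
theorem partialSum_add_single_two_self (hq0 : q ≠ 0) (hq1 : ∀ n : ℕ, 0 < n → q ^ n ≠ 1)
    (L : ℕ → ℤ) (n : ℕ) (x J : ℤ) :
    partialSum q (L + Pi.single (n + 1) 2) (n + 2) x J
      = q ^ J * partialSum q (L + Pi.single n 1) (n + 2) (x + 1) J
        + q ^ ((n + 1 : ℕ) + ∑ i ∈ Finset.range (n + 2), i * L i)
          * partialSum q L (n + 2) x (J - (n + 1 : ℕ)) := by
  set s := ∑ i ∈ Finset.range (n + 1), (i : ℤ) * L i with hs
  set L1 : ℕ → ℤ := L + Pi.single n 1 with hL1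
  set A : ℕ := n + 1 with hA
  have eL : L1 A = L A := by simp [hL1, hA]
  have hf := finite_support_summand (q := q) L1 A x (J - 1)
    (fun j => L1 A * (J - j) - j * (x + 1) - (L1 A + j + 1)) (fun j => L1 A + j + 1)
  have hg := finite_support_summand (q := q) L1 A x J
    (fun j => L1 A * (J - j) - j * (x + 1)) (fun j => L1 A + j)
  have hh := finite_support_summand (q := q) L A x (J - A)
    (fun j => L A * (J - A - j) - j * x) (fun j => L A + j)
  rw [show n + 2 = A + 1 from rfl, partialSum_succ_add_one hq0 hq1,
    ← finsum_add_distrib hg hf, partialSum_succ, partialSum_succ, mul_finsum, mul_finsum,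
    ← finsum_add_distrib (finite_support_const_mul _ ((hg.union hf).subset
      (Function.support_add _ _))) (finite_support_const_mul _ hh)]
  refine finsum_congr fun j => ?_
  have h1 := partialSum_add_single_pred' hq0 hq1 L n (L A + j) (J - j)
  have h2 := partialSum_add_single_pred hq0 hq1 L n (L A + j + 1) (J - 1 - j)
  rw [← hL1, ← hA] at h1 h2
  rw [show J - 1 - j + 1 = J - j by ring] at h2
  have hc := partialSum_congr (q := q) (L := L + Pi.single A 2) (L' := L) (n := A)
    (fun i hi => by simp [hi.ne]) (L A + j + 1 + 1) (J - j)
  have e3 : (L + Pi.single A 2 : ℕ → ℤ) A = L A + 2 := by simp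
  rw [eL, e3, show L A + 2 + j = L A + j + 1 + 1 by ring, hc, h1, h2,
    show J - j - (A : ℤ) = J - A - j by ring]
  have e4 : q ^ J * q ^ (L A * (J - j) - j * (x + 1)) * q ^ (J - j)
      = q ^ ((L A + 2) * (J - j) - j * x) := by
    rw [← zpow_add₀ hq0, ← zpow_add₀ hq0]; congr 1; ring
  have e5 : q ^ J * q ^ (L A * (J - j) - j * (x + 1) - (L A + j + 1))
        * q ^ (L A + j + 1 + (J - 1 - j) + 1)
      = q ^ ((L A + 2) * (J - j) - j * x) := by
    rw [← zpow_add₀ hq0, ← zpow_add₀ hq0]; congr 1; ring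
  have e6 : q ^ ((A : ℤ) + ∑ i ∈ Finset.range (A + 1), (i : ℤ) * L i)
        * q ^ (L A * (J - A - j) - j * x)
      = q ^ J * q ^ (L A * (J - j) - j * (x + 1)) * q ^ ((A : ℤ) + s - (J - j)) := by
    rw [← zpow_add₀ hq0, ← zpow_add₀ hq0, ← zpow_add₀ hq0, Finset.sum_range_succ, ← hs]
    congr 1; ring
  linear_combination (-qBin q x j * partialSum q L A (L A + j + 1) (J - j)) * e4
    + (-qBin q x j * (partialSum q L A (L A + j + 1 + 1) (J - j)
      - partialSum q L A (L A + j + 1) (J - j))) * e5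
    - qBin q x j * partialSum q L A (L A + j) (J - A - j) * e6

/-- Further layers on top only carry the relation along, each contributing (n + 1) L_N to the
exponent. -/
theorem partialSum_add_single_two (hq0 : q ≠ 0) (hq1 : ∀ n : ℕ, 0 < n → q ^ n ≠ 1)
    (L : ℕ → ℤ) (n m : ℕ) (x J : ℤ) :
    partialSum q (L + Pi.single (n + 1) 2) (n + 3 + m) x J
      = partialSum q (L + Pi.single n 1 + Pi.single (n + 2) 1) (n + 3 + m) x J
        + q ^ ((n + 1 : ℕ) + ∑ i ∈ Finset.range (n + 3 + m), (min i (n + 1) : ℕ) * L i)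
          * partialSum q L (n + 3 + m) x (J - (n + 1 : ℕ)) := by
  -- One more layer over a relation that holds `j` by `j`. Entry N may still be raised in the middle
  -- term: at N = n + 2 the unit e_{n+2} becomes the `x + 1` of the preceding lemma.
  have key : ∀ N : ℕ, ∀ c x J : ℤ, (L + Pi.single (n + 1) 2 : ℕ → ℤ) N = L N →
      (∀ j : ℤ, q ^ (L N * (J - j) - j * x) * partialSum q (L + Pi.single (n + 1) 2) N (L N + j)
          (J - j)
        = q ^ ((L + Pi.single n 1 + Pi.single (n + 2) 1 : ℕ → ℤ) N * (J - j) - j * x)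
            * partialSum q (L + Pi.single n 1 + Pi.single (n + 2) 1) N
              ((L + Pi.single n 1 + Pi.single (n + 2) 1 : ℕ → ℤ) N + j) (J - j)
          + q ^ (L N * (J - j) - j * x) * (q ^ c * partialSum q L N (L N + j)
            (J - j - (n + 1 : ℕ)))) →
      partialSum q (L + Pi.single (n + 1) 2) (N + 1) x J
        = partialSum q (L + Pi.single n 1 + Pi.single (n + 2) 1) (N + 1) x J
        + q ^ (c + (n + 1 : ℕ) * L N) * partialSum q L (N + 1) x (J - (n + 1 : ℕ)) := by
    intro N c x J hN h
    have hf := finite_support_summand (q := q) (L + Pi.single n 1 + Pi.single (n + 2) 1) N x J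
      (fun j => (L + Pi.single n 1 + Pi.single (n + 2) 1 : ℕ → ℤ) N * (J - j) - j * x)
      (fun j => (L + Pi.single n 1 + Pi.single (n + 2) 1 : ℕ → ℤ) N + j)
    have hh := finite_support_summand (q := q) L N x (J - (n + 1 : ℕ))
      (fun j => L N * (J - (n + 1 : ℕ) - j) - j * x) (fun j => L N + j)
    rw [partialSum_succ, partialSum_succ, partialSum_succ, mul_finsum,
      ← finsum_add_distrib hf (finite_support_const_mul _ hh)]
    refine finsum_congr fun j => ?_
    rw [hN]
    have e : q ^ (c + (n + 1 : ℕ) * L N) * q ^ (L N * (J - (n + 1 : ℕ) - j) - j * x)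
        = q ^ (L N * (J - j) - j * x) * q ^ c := by
      rw [← zpow_add₀ hq0, ← zpow_add₀ hq0]; congr 1; ring
    rw [show J - ((n + 1 : ℕ) : ℤ) - j = J - j - (n + 1 : ℕ) by ring] at *
    linear_combination qBin q x j * h j - qBin q x j * partialSum q L N (L N + j)
      (J - j - (n + 1 : ℕ)) * e
  induction m generalizing x J with
  | zero =>
    have h0 := key (n + 2) ((n + 1 : ℕ) + ∑ i ∈ Finset.range (n + 2), i * L i) x J (by simp) ?_
    · rw [add_zero, h0, Finset.sum_range_succ _ (n + 2)]
      have : ∑ i ∈ Finset.range (n + 2), ((min i (n + 1) : ℕ) : ℤ) * L i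
          = ∑ i ∈ Finset.range (n + 2), (i : ℤ) * L i :=
        Finset.sum_congr rfl fun i hi => by
          rw [min_eq_left (by have := Finset.mem_range.1 hi; omega)]
      rw [this, min_eq_right (by omega), ← add_assoc]
    · intro j
      have h := partialSum_add_single_two_self hq0 hq1 L n (L (n + 2) + j) (J - j)
      have e1 : (L + Pi.single n 1 + Pi.single (n + 2) 1 : ℕ → ℤ) (n + 2) = L (n + 2) + 1 := by
        simp
      have hc := partialSum_congr (q := q) (L := L + Pi.single n 1 + Pi.single (n + 2) 1)
        (L' := L + Pi.single n 1) (n := n + 2) (fun i hi => by simp [hi.ne])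
        (L (n + 2) + j + 1) (J - j)
      rw [e1, show L (n + 2) + 1 + j = L (n + 2) + j + 1 by ring, hc, h]
      have e : q ^ ((L (n + 2) + 1) * (J - j) - j * x)
          = q ^ (L (n + 2) * (J - j) - j * x) * q ^ (J - j) := by
        rw [← zpow_add₀ hq0]; congr 1; ring
      rw [e]
      ring
  | succ m ih =>
    have h0 := key (n + 3 + m) ((n + 1 : ℕ) + ∑ i ∈ Finset.range (n + 3 + m),
      (min i (n + 1) : ℕ) * L i) x J
        (by have : n + 3 + m ≠ n + 1 := by omega
            simp [this]) ?_
    · rw [← add_assoc, h0, Finset.sum_range_succ _ (n + 3 + m), min_eq_right (by omega),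
        ← add_assoc]
    · intro j
      have e1 : (L + Pi.single n 1 + Pi.single (n + 2) 1 : ℕ → ℤ) (n + 3 + m)
          = L (n + 3 + m) := by
        have h1 : n + 3 + m ≠ n := by omega
        have h2 : n + 3 + m ≠ n + 2 := by omega
        simp [h1, h2]
      rw [e1, ih]
      ring

theorem partialSum_succ_zero (hq0 : q ≠ 0) (L : ℕ → ℤ) (n : ℕ) (J : ℤ) :
    partialSum q L (n + 1) 0 J = q ^ (L n * J) * partialSum q L n (L n) J := by
  rw [partialSum_succ, finsum_eq_single _ 0]
  · simp
  · intro j hj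
    simp [qBin_zero_left hq0, hj]

/-- With nonnegative entries each `j` is at most the top of its binomial, and these bounds add up
from the outside inwards. -/
theorem partialSum_eq_zero_of_lt (hq0 : q ≠ 0) {L : ℕ → ℤ} {n : ℕ} (hL : ∀ i < n, 0 ≤ L i)
    {x J : ℤ} (hx : 0 ≤ x) (hJ : ∑ i ∈ Finset.range n, i * L i + n * x < J) :
    partialSum q L n x J = 0 := by
  induction n generalizing x J with
  | zero =>
    rw [partialSum_zero, if_neg]
    simp at hJ
    omega
  | succ n ih =>
    rw [partialSum_succ, ← finsum_zero (α := ℤ)]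
    refine finsum_congr fun j => ?_
    rcases lt_or_ge j 0 with hj | hj
    · rw [qBin_of_neg _ hj]; simp
    · rcases lt_or_ge x j with hxj | hxj
      · rw [qBin_eq_zero hq0 hx hxj]; simp
      · rw [ih (fun i hi => hL i (by omega)) (add_nonneg (hL n (by omega)) hj), mul_zero]
        rw [Finset.sum_range_succ] at hJ
        push_cast at hJ
        nlinarith

/-- With weights `q^(xJ)` and `q^((x+1)J)`, the recurrence expresses the first difference of `g`
through `f`. Symmetry of `f` makes that difference antisymmetric under J ↦ D + n - 1 - J, so `g (D +
n - J) - g J` is constant in J; at J = -1 both terms lie outside the support. -/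
theorem partialSum_symm_step (hq0 : q ≠ 0) (hq1 : ∀ n : ℕ, 0 < n → q ^ n ≠ 1)
    {L : ℕ → ℤ} {n : ℕ} (hL : ∀ i < n, 0 ≤ L i) {x D : ℤ} (hx : 0 ≤ x)
    (hD : D = ∑ i ∈ Finset.range n, i * L i + n * x)
    (h : ∀ J, q ^ (x * (D - J)) * partialSum q L n x (D - J) = q ^ (x * J) * partialSum q L n x J)
    (J : ℤ) :
    q ^ ((x + 1) * (D + n - J)) * partialSum q L n (x + 1) (D + n - J)
      = q ^ ((x + 1) * J) * partialSum q L n (x + 1) J := by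
  set f : ℤ → K := fun J => q ^ (x * J) * partialSum q L n x J with hf
  set g : ℤ → K := fun J => q ^ ((x + 1) * J) * partialSum q L n (x + 1) J with hg
  have hr : ∀ J, g (J + 1) - g J = q ^ (J + 1) * f (J + 1) - q ^ (D + n - J) * f (J - n) := by
    intro J
    have h1 := partialSum_recurrence hq0 hq1 L n x J
    simp only [hf, hg]
    have e1 : q ^ ((x + 1) * (J + 1)) = q ^ ((x + 1) * J) * q ^ (x + 1) := by
      rw [← zpow_add₀ hq0]; congr 1; ring
    have e2 : q ^ (J + 1) * q ^ (x * (J + 1)) = q ^ ((x + 1) * J) * q ^ (x + 1) := by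
      rw [← zpow_add₀ hq0, ← zpow_add₀ hq0]; congr 1; ring
    have e3 : q ^ (D + n - J) * q ^ (x * (J - n)) = q ^ ((x + 1) * J) *
        q ^ (n + ∑ i ∈ Finset.range n, i * L i - 2 * J) := by
      rw [← zpow_add₀ hq0, ← zpow_add₀ hq0, hD]; congr 1; ring
    rw [← mul_assoc, ← mul_assoc, e2, e3, e1]
    linear_combination q ^ ((x + 1) * J) * h1
  have hstep : ∀ J, g (D + n - (J + 1)) - g (J + 1) = g (D + n - J) - g J := by
    intro J
    have h1 := hr J
    have h2 := hr (D + n - (J + 1))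
    have h3 := h (J + 1)
    have h4 := h (J - n)
    rw [show D + n - (J + 1) + 1 = D + n - J by ring,
      show D + n - (D + n - (J + 1)) = J + 1 by ring,
      show D + n - (J + 1) - n = D - (J + 1) by ring] at h2
    rw [show D - (J - n) = D + n - J by ring] at h4
    change f (D - (J + 1)) = f (J + 1) at h3
    change f (D + n - J) = f (J - n) at h4
    rw [h3, h4] at h2
    linear_combination -h1 - h2
  have hconst : ∀ J, g (D + n - J) - g J = g (D + n - (-1)) - g (-1) := by
    intro J
    induction J using Int.inductionOn' (b := -1) with
    | zero => rfl
    | succ J _ ih => rw [hstep, ih]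
    | pred J _ ih =>
      have := hstep (J - 1)
      rw [sub_add_cancel] at this
      rw [← this, ih]
  have h0 := hconst J
  have hz1 : g (D + n - (-1)) = 0 := by
    simp only [hg]
    rw [partialSum_eq_zero_of_lt hq0 hL (by omega) (by rw [hD]; linarith), mul_zero]
  have hz2 : g (-1) = 0 := by
    simp only [hg]
    rw [partialSum_of_neg _ _ _ (by norm_num), mul_zero]
  rw [hz1, hz2, sub_self, sub_eq_zero] at h0
  exact h0

/-- At `x = 0` the outermost layer disappears and leaves the claim for `n` layers at `x = L n`;
larger `x` follow by the step above. -/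
theorem partialSum_symm (hq0 : q ≠ 0) (hq1 : ∀ n : ℕ, 0 < n → q ^ n ≠ 1)
    {L : ℕ → ℤ} {n : ℕ} (hL : ∀ i < n, 0 ≤ L i) (x : ℕ) (J : ℤ) :
    q ^ (x * (∑ i ∈ Finset.range n, i * L i + n * x - J))
        * partialSum q L n x (∑ i ∈ Finset.range n, i * L i + n * x - J)
      = q ^ (x * J) * partialSum q L n x J := by
  induction n generalizing x J with
  | zero =>
    by_cases h : J = 0 <;> simp [partialSum_zero, h]
  | succ n ih =>
    induction x generalizing J with
    | zero =>
      have hn := hL n (by omega)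
      obtain ⟨y, hy⟩ := Int.eq_ofNat_of_zero_le hn
      have := ih (fun i hi => hL i (by omega)) y J
      simp only [Nat.cast_zero, mul_zero, zero_mul, zpow_zero, one_mul, add_zero]
      rw [partialSum_succ_zero hq0, partialSum_succ_zero hq0, Finset.sum_range_succ, hy]
      exact this
    | succ x ihx =>
      have := partialSum_symm_step hq0 hq1 hL (Nat.cast_nonneg x) rfl ihx J
      push_cast at this ⊢
      rw [show ∀ s : ℤ, s + ((n : ℤ) + 1) * (x + 1) - J = s + (n + 1) * x + (n + 1) - J by
        intro s; ring]
      exact this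

end PartialSums

/-! ### From quadratic to mixed recurrences, and uniqueness of their solution. -/

section Recurrences

variable {K : Type*} [Field K] {q : K}

/-- The quadratic recurrences, which raise one entry of `L` by two, imply mixed ones, in which
`e_A + e_B` is added to an `L` whose entries before the `B`-th one vanish. -/
theorem mixed_recurrence (hq0 : q ≠ 0) {k : ℕ} {G : (ℕ → ℤ) → K}
    (h0 : ∀ L, G (L + Pi.single 0 1) = G L)
    (hb : ∀ (A : ℕ) (L : ℕ → ℤ), 1 ≤ A → A ≤ k → (∀ i, 1 ≤ i → -1 ≤ L i) →
      (∀ i, k ≤ i → 0 ≤ L i) →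
      G (L + Pi.single A 2) = G (L + Pi.single (A - 1) 1 + Pi.single (A + 1) 1)
        + q ^ (A + ∑ i ∈ Finset.range (k + 2), (min i A : ℕ) * L i) * G L)
    (A B : ℕ) (L : ℕ → ℤ) (hA : 1 ≤ A) (hAB : A ≤ B) (hB : B ≤ k)
    (hz : ∀ i, 1 ≤ i → i < B → L i = 0) (hn : ∀ i, 1 ≤ i → -1 ≤ L i) (hk : ∀ i, k ≤ i → 0 ≤ L i) :
    G (L + Pi.single A 1 + Pi.single B 1)
      = G (L + Pi.single (A - 1) 1 + Pi.single (B + 1) 1)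
        + q ^ (A * (∑ i ∈ Finset.Icc 1 (k + 1), L i + 1)) * G (L + Pi.single (B - A) 1) := by
  have hsum : ∀ (A : ℕ) (L : ℕ → ℤ), (∀ i, 1 ≤ i → i < A → L i = 0) →
      ∑ i ∈ Finset.range (k + 2), ((min i A : ℕ) : ℤ) * L i
        = A * ∑ i ∈ Finset.Icc 1 (k + 1), L i := by
    intro A L hz
    rw [Finset.range_eq_Ico, Finset.sum_eq_sum_Ico_succ_bot (by omega), Finset.mul_sum]
    simp only [Nat.zero_min, Nat.cast_zero, zero_mul, zero_add]
    refine Finset.sum_congr (by ext; simp; omega) fun i hi => ?_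
    simp only [Finset.mem_Icc] at hi
    rcases lt_or_ge i A with h | h
    · rw [hz i hi.1 h]; simp
    · rw [min_eq_right h]
  induction B generalizing A L with
  | zero => omega
  | succ B ih =>
    rcases hAB.eq_or_lt with rfl | hlt
    · have h := hb (B + 1) L hA hB hn hk
      rw [add_assoc, ← Pi.single_add, one_add_one_eq_two, h, hsum _ _ hz, Nat.sub_self, h0]
      congr 3
      ring
    · have hAB' : A ≤ B := by omega
      have s1 : ∀ j, j ∈ Finset.Icc 1 (k + 1) →
          ∑ i ∈ Finset.Icc 1 (k + 1), (Pi.single j 1 : ℕ → ℤ) i = 1 := fun j hj => by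
        rw [Finset.sum_pi_single', if_pos hj]
      have r1 := ih A (L - Pi.single B 1 + Pi.single (B + 1) 1) hA hAB' (by omega)
        (fun i h1 h2 => by
          have h3 : i ≠ B := by omega
          have h4 : i ≠ B + 1 := by omega
          simp [h3, h4, hz i h1 (by omega)])
        (fun i h1 => by
          rcases eq_or_ne i B with rfl | h3
          · simp [hz i h1 (by omega)]
          · have := hn i h1
            rcases eq_or_ne i (B + 1) with rfl | h4
            · simp; omega
            · simp [h3, h4, this])
        (fun i h1 => by
          have := hk i h1
          have h3 : i ≠ B := by omega
          rcases eq_or_ne i (B + 1) with rfl | h4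
          · simp; omega
          · simp [h3, h4, this])
      have r3 := ih (B + 1 - A) (L - Pi.single B 1) (by omega) (by omega) (by omega)
        (fun i h1 h2 => by
          have h3 : i ≠ B := by omega
          simp [h3, hz i h1 (by omega)])
        (fun i h1 => by
          rcases eq_or_ne i B with rfl | h3
          · simp [hz i h1 (by omega)]
          · simp [h3, hn i h1])
        (fun i h1 => by
          have h3 : i ≠ B := by omega
          simp [h3, hk i h1])
      have r2 := hb (B + 1) (L - Pi.single B 1 + Pi.single (A - 1) 1) (by omega) hB
        (fun i h1 => by
          have h5 : 0 ≤ (Pi.single (A - 1) 1 : ℕ → ℤ) i := by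
            rw [Pi.single_apply]; split_ifs <;> norm_num
          rcases eq_or_ne i B with rfl | h3
          · simp [hz i h1 (by omega), h5]
          · have := hn i h1
            simp only [Pi.add_apply, Pi.sub_apply, Pi.single_eq_of_ne h3]
            omega)
        (fun i h1 => by
          have h5 : 0 ≤ (Pi.single (A - 1) 1 : ℕ → ℤ) i := by
            rw [Pi.single_apply]; split_ifs <;> norm_num
          have h3 : i ≠ B := by omega
          have := hk i h1
          simp only [Pi.add_apply, Pi.sub_apply, Pi.single_eq_of_ne h3]
          omega)
      have t1 : ∑ i ∈ Finset.Icc 1 (k + 1), (L - Pi.single B 1 + Pi.single (B + 1) 1 : ℕ → ℤ) i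
          = ∑ i ∈ Finset.Icc 1 (k + 1), L i := by
        simp only [Pi.add_apply, Pi.sub_apply, Finset.sum_add_distrib, Finset.sum_sub_distrib]
        rw [s1 _ (by simp; omega), s1 _ (by simp; omega)]
        ring
      have t3 : ∑ i ∈ Finset.Icc 1 (k + 1), (L - Pi.single B 1 : ℕ → ℤ) i
          = ∑ i ∈ Finset.Icc 1 (k + 1), L i - 1 := by
        simp only [Pi.sub_apply, Finset.sum_sub_distrib]
        rw [s1 _ (by simp; omega)]
      have t2 : ∑ i ∈ Finset.range (k + 2), ((min i (B + 1) : ℕ) : ℤ)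
            * (L - Pi.single B 1 + Pi.single (A - 1) 1 : ℕ → ℤ) i
          = (B + 1 : ℕ) * ∑ i ∈ Finset.Icc 1 (k + 1), L i - B + (A - 1 : ℕ) := by
        have s2 : ∀ j, j ≤ B → ∑ i ∈ Finset.range (k + 2), ((min i (B + 1) : ℕ) : ℤ)
            * (Pi.single j 1 : ℕ → ℤ) i = j := by
          intro j hj
          rw [Finset.sum_eq_single j]
          · simp; omega
          · intro i _ hi; simp [hi]
          · simp; omega
        simp only [Pi.add_apply, Pi.sub_apply, mul_add, mul_sub, Finset.sum_add_distrib,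
          Finset.sum_sub_distrib]
        rw [s2 _ le_rfl, s2 _ (by omega), hsum _ _ hz]
      rw [t1] at r1
      rw [t2] at r2
      rw [t3] at r3
      rw [show L - Pi.single B 1 + Pi.single (B + 1) 1 + Pi.single A 1 + Pi.single B 1
          = L + Pi.single A 1 + Pi.single (B + 1) 1 by abel,
        show L - Pi.single B 1 + Pi.single (B + 1) 1 + Pi.single (A - 1) 1 + Pi.single (B + 1) 1
          = L - Pi.single B 1 + Pi.single (A - 1) 1
            + (Pi.single (B + 1) 1 + Pi.single (B + 1) 1) by abel,
        ← Pi.single_add, one_add_one_eq_two, r2, Nat.add_sub_cancel,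
        show L - Pi.single B 1 + Pi.single (A - 1) 1 + Pi.single B 1 + Pi.single (B + 1 + 1) 1
          = L + Pi.single (A - 1) 1 + Pi.single (B + 1 + 1) 1 by abel] at r1
      rw [show L - Pi.single B 1 + Pi.single (B + 1 - A) 1 + Pi.single B 1
          = L + Pi.single (B + 1 - A) 1 by abel,
        show B + 1 - A - 1 = B - A by omega, show B - (B + 1 - A) = A - 1 by omega,
        show L - Pi.single B 1 + Pi.single (B - A) 1 + Pi.single (B + 1) 1
          = L - Pi.single B 1 + Pi.single (B + 1) 1 + Pi.single (B - A) 1 by abel] at r3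
      set σ := ∑ i ∈ Finset.Icc 1 (k + 1), L i
      have e : q ^ (((B + 1 : ℕ) : ℤ) + ((B + 1 : ℕ) * σ - B + (A - 1 : ℕ)))
          = q ^ (A * (σ + 1)) * q ^ (((B + 1 - A : ℕ) : ℤ) * (σ - 1 + 1)) := by
        rw [← zpow_add₀ hq0]
        congr 1
        push_cast [Nat.cast_sub (show A ≤ B + 1 by omega), Nat.cast_sub hA]
        ring
      rw [r1, r3, e]
      ring

theorem exists_min_entry {L : ℕ → ℤ} (h : ¬ ∀ i, 1 ≤ i → L i = 0) :
    ∃ B, 1 ≤ B ∧ L B ≠ 0 ∧ ∀ i, 1 ≤ i → i < B → L i = 0 := by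
  classical
  push Not at h
  refine ⟨Nat.find h, (Nat.find_spec h).1, (Nat.find_spec h).2, fun i h1 h2 => ?_⟩
  by_contra h3
  exact Nat.find_min h h2 ⟨h1, h3⟩

/-- The mixed recurrences determine a function from its values at the `L` with at most one entry,
which is then `1`. -/
theorem eq_zero_of_mixed_recurrence {k : ℕ} {F : (ℕ → ℤ) → K} (c : ℕ → ℕ → (ℕ → ℤ) → K)
    (hc : ∀ L L' : ℕ → ℤ, (∀ i, 1 ≤ i → L i = L' i) → F L = F L')
    (hfold : ∀ L : ℕ → ℤ, F (L + Pi.single (k + 1) 1) = F (L + Pi.single k 1))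
    (hr : ∀ (A B : ℕ) (L : ℕ → ℤ), 1 ≤ A → A ≤ B → B ≤ k → (∀ i, 0 ≤ L i) →
      (∀ i, k < i → L i = 0) → (∀ i, 1 ≤ i → i < B → L i = 0) →
      F (L + Pi.single A 1 + Pi.single B 1)
        = F (L + Pi.single (A - 1) 1 + Pi.single (B + 1) 1)
          + c A B L * F (L + Pi.single (B - A) 1))
    (hinit : ∀ B, B ≤ k → F (Pi.single B 1) = 0)
    (L : ℕ → ℤ) (hL : ∀ i, 0 ≤ L i) (hk : ∀ i, k < i → L i = 0) : F L = 0 := by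
  have single_nonneg : ∀ j i : ℕ, 0 ≤ (Pi.single j 1 : ℕ → ℤ) i := fun j i => by
    rw [Pi.single_apply]; split_ifs <;> norm_num
  have sub_nonneg : ∀ (L : ℕ → ℤ) (B : ℕ), (∀ i, 0 ≤ L i) → L B ≠ 0 →
      ∀ i, 0 ≤ (L - Pi.single B 1 : ℕ → ℤ) i := by
    intro L B h1 h2 i
    have := h1 i
    rcases eq_or_ne i B with rfl | h
    · simp; omega
    · simp [h, this]
  have sum_single : ∀ j, 1 ≤ j → j ≤ k →
      ∑ i ∈ Finset.Icc 1 k, (Pi.single j 1 : ℕ → ℤ) i = 1 := fun j h1 h2 => by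
    rw [Finset.sum_pi_single', if_pos (by simp [h1, h2])]
  have sum_single_le : ∀ j,
      ∑ i ∈ Finset.Icc 1 k, (Pi.single j 1 : ℕ → ℤ) i ≤ 1 := fun j => by
    rw [Finset.sum_pi_single']; split_ifs <;> norm_num
  have zero_of : ∀ j i : ℕ, j ≤ k → k < i → (Pi.single j 1 : ℕ → ℤ) i = 0 := fun j i h1 h2 => by
    rw [Pi.single_eq_of_ne (by omega)]
  obtain ⟨s, hs⟩ : ∃ s : ℕ, ∑ i ∈ Finset.Icc 1 k, L i = s :=
    Int.eq_ofNat_of_zero_le (Finset.sum_nonneg fun i _ => hL i)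
  induction s using Nat.strong_induction_on generalizing L with
  | _ s ih =>
  have small : ∀ L : ℕ → ℤ, (∀ i, 0 ≤ L i) → (∀ i, k < i → L i = 0) →
      ∑ i ∈ Finset.Icc 1 k, L i < s → F L = 0 := by
    intro L h1 h2 h3
    obtain ⟨t, ht⟩ := Int.eq_ofNat_of_zero_le (Finset.sum_nonneg fun i (_ : i ∈ Finset.Icc 1 k) =>
      h1 i)
    exact ih t (by omega) L h1 h2 ht
  -- With the total of L below `s`, the recurrence lowers A in one term and leaves a total below `s`
  -- in the other; at A = 0 the unit is invisible to `F`.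
  have inner : ∀ A, A ≤ k → ∀ L : ℕ → ℤ, (∀ i, 0 ≤ L i) → (∀ i, k < i → L i = 0) →
      (∀ i, 1 ≤ i → i < A → L i = 0) → ∑ i ∈ Finset.Icc 1 k, L i < s →
      F (L + Pi.single A 1) = 0 := by
    intro A
    induction A with
    | zero =>
      intro _ L h1 h2 _ h4
      rw [hc (L + Pi.single 0 1) L fun i hi => by simp [show i ≠ 0 by omega]]
      exact small L h1 h2 h4
    | succ A ihA =>
      intro hA L h1 h2 h3 h4
      by_cases h : ∀ i, 1 ≤ i → L i = 0
      · rw [hc (L + Pi.single (A + 1) 1) (Pi.single (A + 1) 1) fun i hi => by simp [h i hi]]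
        exact hinit _ hA
      · obtain ⟨B, hB1, hB0, hBmin⟩ := exists_min_entry h
        have hAB : A + 1 ≤ B := by
          by_contra h5
          exact hB0 (h3 B hB1 (by omega))
        have hBk : B ≤ k := by
          by_contra h5
          exact hB0 (h2 B (by omega))
        have hsum : ∑ i ∈ Finset.Icc 1 k, (L - Pi.single B 1 : ℕ → ℤ) i
            = ∑ i ∈ Finset.Icc 1 k, L i - 1 := by
          simp only [Pi.sub_apply, Finset.sum_sub_distrib, sum_single B hB1 hBk]
        have hsup : ∀ i, k < i → (L - Pi.single B 1 : ℕ → ℤ) i = 0 := fun i hi => by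
          simp [h2 i hi, zero_of B i hBk hi]
        have r := hr (A + 1) B (L - Pi.single B 1) (by omega) hAB hBk (sub_nonneg L B h1 hB0)
          hsup (fun i h5 h6 => by simp [hBmin i h5 h6, h6.ne])
        rw [show L - Pi.single B 1 + Pi.single (A + 1) 1 + Pi.single B 1
          = L + Pi.single (A + 1) 1 by abel] at r
        rw [r, Nat.add_sub_cancel]
        have z2 : F (L - Pi.single B 1 + Pi.single (B - (A + 1)) 1) = 0 := by
          refine small _ (fun i => add_nonneg (sub_nonneg L B h1 hB0 i) (single_nonneg _ _))
            (fun i hi => ?_) ?_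
          · rw [Pi.add_apply, hsup i hi, zero_of _ i (by omega) hi, add_zero]
          · simp only [Pi.add_apply _ (Pi.single (B - (A + 1)) 1), Finset.sum_add_distrib]
            rw [hsum]
            have := sum_single_le (B - (A + 1))
            omega
        -- The unit moved from B to B + 1 stays in L, or folds back onto k if B = k; e_A is the unit
        -- of smaller index.
        have z1 : F (L - Pi.single B 1 + Pi.single A 1 + Pi.single (B + 1) 1) = 0 := by
          rcases hBk.eq_or_lt with rfl | hlt
          · rw [hfold, show L - Pi.single B 1 + Pi.single A 1 + Pi.single B 1
              = L + Pi.single A 1 by abel]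
            exact ihA (by omega) L h1 h2 (fun i h5 h6 => h3 i h5 (by omega)) h4
          · rw [add_right_comm]
            refine ihA (by omega) _
              (fun i => add_nonneg (sub_nonneg L B h1 hB0 i) (single_nonneg _ _))
              (fun i hi => ?_) (fun i h5 h6 => ?_) ?_
            · rw [Pi.add_apply, hsup i hi, zero_of _ i (by omega) hi, add_zero]
            · have h7 : i ≠ B := by omega
              have h8 : i ≠ B + 1 := by omega
              simp [h7, h8, hBmin i h5 (by omega)]
            · simp only [Pi.add_apply _ (Pi.single (B + 1) 1), Finset.sum_add_distrib]
              rw [hsum]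
              have := sum_single_le (B + 1)
              omega
        rw [z1, z2]
        simp
  by_cases h : ∀ i, 1 ≤ i → L i = 0
  · rw [hc L (Pi.single 0 1) fun i hi => by simp [h i hi, show i ≠ 0 by omega]]
    exact hinit 0 (Nat.zero_le _)
  · obtain ⟨B, hB1, hB0, hBmin⟩ := exists_min_entry h
    have hBk : B ≤ k := by
      by_contra h5
      exact hB0 (hk B (by omega))
    have hsum : ∑ i ∈ Finset.Icc 1 k, (L - Pi.single B 1 : ℕ → ℤ) i
        = ∑ i ∈ Finset.Icc 1 k, L i - 1 := by
      simp only [Pi.sub_apply, Finset.sum_sub_distrib, sum_single B hB1 hBk]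
    have := inner B hBk (L - Pi.single B 1) (sub_nonneg L B hL hB0)
      (fun i hi => by simp [hk i hi, zero_of B i hBk hi])
      (fun i h5 h6 => by simp [hBmin i h5 h6, h6.ne]) (by rw [hsum]; omega)
    rwa [sub_add_cancel] at this

end Recurrences

/-! ### The tadpole matrix and its inverse. -/

section Tadpole

/-- T is minus the second difference, with boundary value 0 on the left and a repeated value on the
right. -/
theorem tadpole_mulVec {k : ℕ} (w : ℕ → ℤ) (h0 : w 0 = 0) (hk : w (k + 1) = w k) (i : Fin k) :
    (tadpole k *ᵥ fun j => w (j + 1)) i = 2 * w (i + 1) - w i - w (i + 2) := by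
  have hi := i.isLt
  have h : ∀ j : Fin k, tadpole k i j * w (j + 1)
      = (if (i : ℕ) = j then (2 - if (j : ℕ) + 1 = k then 1 else 0) * w (j + 1) else 0)
        - (if (i : ℕ) + 1 = j then w (j + 1) else 0)
        - (if (j : ℕ) + 1 = (i : ℕ) then w (j + 1) else 0) := by
    intro j
    simp only [tadpole, Fin.ext_iff]
    by_cases h1 : (i : ℕ) = j
    · have h2 : ¬ (i : ℕ) + 1 = j := by omega
      have h3 : ¬ (j : ℕ) + 1 = i := by omega
      simp [h1]
    · by_cases h2 : (i : ℕ) + 1 = j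
      · have h3 : ¬ (j : ℕ) + 1 = i := by omega
        simp [h1, h2, h3]
      · simp [h1, h2]
  rw [Matrix.mulVec, dotProduct, Finset.sum_congr rfl fun j _ => h j,
    Fin.sum_univ_eq_sum_range (fun j : ℕ =>
      (if (i : ℕ) = j then (2 - if j + 1 = k then 1 else 0) * w (j + 1) else 0)
        - (if (i : ℕ) + 1 = j then w (j + 1) else 0)
        - (if j + 1 = (i : ℕ) then w (j + 1) else 0)) k]
  rw [Finset.sum_sub_distrib, Finset.sum_sub_distrib, Finset.sum_ite_eq, Finset.sum_ite_eq,
    if_pos (by simp)]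
  have h3 : ∑ j ∈ Finset.range k, (if j + 1 = (i : ℕ) then w (j + 1) else 0) = w i := by
    rcases Nat.eq_zero_or_pos (i : ℕ) with h | h
    · rw [h, h0]
      exact Finset.sum_eq_zero fun j _ => by simp
    · rw [Finset.sum_eq_single ((i : ℕ) - 1)]
      · rw [Nat.sub_add_cancel h]; simp
      · intro j _ hj
        rw [if_neg (by omega)]
      · intro hj
        simp at hj
        omega
  rw [h3]
  by_cases h4 : (i : ℕ) + 1 = k
  · rw [if_pos h4, if_neg (by simp; omega)]
    rw [show (i : ℕ) + 2 = k + 1 by omega, hk, h4]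
    ring
  · rw [if_neg h4, if_pos (by simp; omega)]
    ring_nf

theorem tadpole_mul_min (k : ℕ) :
    tadpole k * Matrix.of (fun i j : Fin k => ((min (i + 1) (j + 1) : ℕ) : ℤ)) = 1 := by
  ext i j
  have := tadpole_mulVec (k := k) (fun n => ((min n (j + 1) : ℕ) : ℤ)) (by simp)
    (by have := j.isLt; congr 1; omega) i
  rw [Matrix.mul_apply]
  refine Eq.trans this ?_
  rw [Matrix.one_apply]
  simp only [Fin.ext_iff]
  split_ifs <;> omega

theorem tadpole_inv (k : ℕ) :
    (tadpole k)⁻¹ = Matrix.of (fun i j : Fin k => ((min (i + 1) (j + 1) : ℕ) : ℤ)) :=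
  Matrix.inv_eq_right_inv (tadpole_mul_min k)

theorem tadpole_mulVec_injective (k : ℕ) : Function.Injective (tadpole k).mulVec := by
  intro v w h
  have h1 := mul_eq_one_comm.1 (tadpole_mul_min k)
  have h2 := congrArg (fun u =>
    Matrix.of (fun i j : Fin k => ((min (i + 1) (j + 1) : ℕ) : ℤ)) *ᵥ u) h
  simpa only [Matrix.mulVec_mulVec, h1, Matrix.one_mulVec] using h2

theorem ellLast_eq {N : ℕ} (L : Fin N → ℤ) : ellLast L = ∑ i : Fin N, (((i : ℕ) : ℤ) + 1) * L i := by
  rw [ellLast, tadpole_inv]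
  cases N with
  | zero => simp
  | succ n =>
    have h : unitVec (n + 1) (n + 1) = Pi.single (Fin.last n) 1 := by
      ext i
      simp only [unitVec, Pi.single_apply, Fin.ext_iff, Fin.val_last]
      split_ifs <;> omega
    rw [h, single_one_dotProduct, Matrix.mulVec, dotProduct]
    refine Finset.sum_congr rfl fun i _ => ?_
    simp only [Matrix.of_apply, Fin.val_last]
    rw [min_eq_right (by have := i.isLt; omega)]
    push_cast
    ring

theorem tadpole_mulVec_le {k : ℕ} {v : Fin k → ℤ} (hv : ∀ i, 0 ≤ v i) (i : Fin k) :
    (tadpole k *ᵥ v) i ≤ 2 * v i := by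
  rw [Matrix.mulVec, dotProduct, ← Finset.add_sum_erase _ _ (Finset.mem_univ i)]
  have h1 : tadpole k i i * v i ≤ 2 * v i := by
    refine mul_le_mul_of_nonneg_right ?_ (hv i)
    simp only [tadpole, if_true]
    split_ifs <;> omega
  have h2 : ∑ j ∈ Finset.univ.erase i, tadpole k i j * v j ≤ 0 := by
    refine Finset.sum_nonpos fun j hj => mul_nonpos_of_nonpos_of_nonneg ?_ (hv j)
    have : i ≠ j := (Finset.ne_of_mem_erase hj).symm
    simp only [tadpole, if_neg this]
    split_ifs <;> omega
  linarith

end Tadpole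

/-! ### Fermionic summands: finiteness and a termwise recurrence. -/

section Fermionic

variable {K : Type*} [Field K] {q : K} {k : ℕ}

theorem bigN_eq (n : Fin k → ℤ) (j : Fin k) :
    bigN n j = ∑ i : Fin k, if (j : ℕ) ≤ i then n i else 0 := by
  rw [bigN, ← Finset.sum_filter]
  refine Finset.sum_congr ?_ fun _ _ => rfl
  ext i
  simp

theorem xExponent_eq (n : Fin k → ℤ) (j : Fin k) :
    xExponent n j = 2 * ∑ m ∈ Finset.range (j + 1), ∑ i : Fin k, if m ≤ i then n i else 0 := by
  have : ∀ f : ℕ → ℤ, ∑ m ∈ Finset.Iic j, f m = ∑ m ∈ Finset.range (j + 1), f m := by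
    intro f
    refine Finset.sum_bij (fun m _ => (m : ℕ)) (fun m hm => ?_) (fun m _ m' _ h => Fin.ext h)
      (fun m hm => ?_) (fun _ _ => rfl)
    · have : m ≤ j := Finset.mem_Iic.1 hm
      simp only [Finset.mem_range]
      omega
    · have hm' := Finset.mem_range.1 hm
      exact ⟨⟨m, by omega⟩, Finset.mem_Iic.2 (Fin.le_def.2 (by simp; omega)), rfl⟩
  rw [xExponent, ← this]
  congr 1
  exact Finset.sum_congr rfl fun m _ => bigN_eq n m

theorem tadpole_mulVec_xExponent (n : Fin k → ℤ) (i : Fin k) :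
    (tadpole k *ᵥ xExponent n) i = 2 * n i := by
  have h := tadpole_mulVec (k := k)
    (fun j => 2 * ∑ m ∈ Finset.range j, ∑ i : Fin k, if m ≤ i then n i else 0) (by simp)
    (by
      rw [Finset.sum_range_succ, Finset.sum_eq_zero (f := fun i : Fin k =>
        if k ≤ (i : ℕ) then n i else 0), add_zero]
      intro i _
      rw [if_neg (by have := i.isLt; omega)]) i
  rw [show xExponent n = fun j => _ from funext fun j => xExponent_eq n j, h]
  rw [Finset.sum_range_succ _ ((i : ℕ) + 1), Finset.sum_range_succ _ (i : ℕ)]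
  have : (∑ j : Fin k, if (i : ℕ) ≤ j then n j else 0)
      - (∑ j : Fin k, if (i : ℕ) + 1 ≤ j then n j else 0) = n i := by
    rw [← Finset.sum_sub_distrib, Finset.sum_eq_single i]
    · simp
    · intro j _ hj
      have : (i : ℕ) ≠ j := fun h => hj (Fin.ext h.symm)
      by_cases h : (i : ℕ) ≤ j
      · rw [if_pos h, if_pos (by omega), sub_self]
      · rw [if_neg h, if_neg (by omega), sub_self]
    · simp
  linarith

theorem bigN_nonneg {n : Fin k → ℤ} (hn : ∀ i, 0 ≤ n i) (j : Fin k) : 0 ≤ bigN n j :=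
  Finset.sum_nonneg fun i _ => hn i

theorem le_xExponent {n : Fin k → ℤ} (hn : ∀ i, 0 ≤ n i) (i j : Fin k) (hij : (j : ℕ) ≤ i) :
    2 * n i ≤ xExponent n j := by
  have h1 : n i ≤ bigN n j :=
    Finset.single_le_sum (f := n) (fun i _ => hn i) (Finset.mem_Ici.2 hij)
  have h2 : bigN n j ≤ ∑ m ∈ Finset.Iic j, bigN n m :=
    Finset.single_le_sum (f := bigN n) (fun i _ => bigN_nonneg hn i)
      (Finset.mem_Iic.2 le_rfl)
  rw [xExponent]
  linarith

/-- A negative n_i with nonzero binomial forces a negative top entry. For v = M - (2N_1 + ⋯ +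
2N_j)_j ≥ 0 this reads 2v_i ≤ -2n_i - 2, while 2v_i ≥ (Tv)_i = (TM)_i - 2n_i ≥ -1 - 2n_i. -/
theorem nonneg_of_fermionicTerm_ne_zero (hq0 : q ≠ 0) {a : ℕ} {M n : Fin k → ℤ}
    (hM : ∀ i, -1 ≤ (tadpole k *ᵥ M) i) (h : fermionicTerm q a M n ≠ 0) :
    (∀ i, 0 ≤ n i) ∧ ∀ i, xExponent n i ≤ M i := by
  have hp := right_ne_zero_of_mul h
  rw [Finset.prod_ne_zero_iff] at hp
  have h1 : ∀ i, xExponent n i ≤ M i := by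
    intro i
    by_contra h2
    exact hp i (Finset.mem_univ i) (qBin_of_neg _ (by omega))
  refine ⟨fun i => ?_, h1⟩
  by_contra h2
  have h3 : M i + n i - xExponent n i < 0 := by
    by_contra h4
    exact hp i (Finset.mem_univ i) (qBin_eq_zero hq0 (by omega) (by omega))
  have h4 := tadpole_mulVec_le (v := M - xExponent n) (fun i => by simp [h1 i]) i
  rw [Matrix.mulVec_sub, Pi.sub_apply, Pi.sub_apply, tadpole_mulVec_xExponent] at h4
  have := hM i
  omega

theorem finite_support_fermionicTerm (hq0 : q ≠ 0) (a : ℕ) {M : Fin k → ℤ}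
    (hM : ∀ i, -1 ≤ (tadpole k *ᵥ M) i) :
    (Function.support fun n : Fin k → ℤ => fermionicTerm q a M n).Finite := by
  refine (Set.finite_Icc (0 : Fin k → ℤ) M).subset fun n hn => ?_
  obtain ⟨h1, h2⟩ := nonneg_of_fermionicTerm_ne_zero hq0 hM hn
  refine ⟨h1, fun i => ?_⟩
  have := le_xExponent h1 i i le_rfl
  have := h2 i
  have := h1 i
  show n i ≤ M i
  omega

theorem bigN_sub_single (n : Fin k → ℤ) (α j : Fin k) :
    bigN (n - Pi.single α 1) j = bigN n j - if j ≤ α then 1 else 0 := by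
  simp only [bigN, Pi.sub_apply, Finset.sum_sub_distrib, Finset.sum_pi_single', Finset.mem_Ici]

theorem xExponent_sub_single (n : Fin k → ℤ) (α j : Fin k) :
    xExponent (n - Pi.single α 1) j
      = xExponent n j - 2 * ((min ((j : ℕ) + 1) (α + 1) : ℕ) : ℤ) := by
  simp only [xExponent, bigN_sub_single, Finset.sum_sub_distrib]
  rw [← Finset.sum_filter, Finset.sum_const, nsmul_eq_mul, mul_one]
  have : Finset.filter (fun m => m ≤ α) (Finset.Iic j) = Finset.Iic (min j α) := by
    ext; simp
  rw [this, Fin.card_Iic, mul_sub, Fin.coe_min]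
  congr 3
  omega

theorem qExponent_eq_sub_single {a : ℕ} (ha : 1 ≤ a) (n : Fin k → ℤ) (α : Fin k) :
    qExponent a n = qExponent a (n - Pi.single α 1) + xExponent n α
      - ((min ((α : ℕ) + 1) (a - 1) : ℕ) : ℤ) := by
  have h1 : ∑ i, bigN (n - Pi.single α 1) i ^ 2
      = ∑ i, bigN n i ^ 2 - xExponent n α + (α + 1) := by
    have e : ∀ i, bigN (n - Pi.single α 1) i ^ 2
        = bigN n i ^ 2 - (if i ≤ α then 2 * bigN n i else 0) + (if i ≤ α then 1 else 0) := by
      intro i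
      rw [bigN_sub_single]
      split_ifs <;> ring
    rw [Finset.sum_congr rfl fun i _ => e i, Finset.sum_add_distrib, Finset.sum_sub_distrib,
      ← Finset.sum_filter, ← Finset.sum_filter, xExponent, Finset.mul_sum]
    have e2 : Finset.filter (fun m => m ≤ α) Finset.univ = Finset.Iic α := by ext; simp
    rw [e2, Finset.sum_const, Fin.card_Iic]
    simp
  have h2 : ∑ i : Fin k with a ≤ i.val + 1, bigN (n - Pi.single α 1) i
      = ∑ i : Fin k with a ≤ i.val + 1, bigN n i
        - ((α : ℕ) + 1 - min ((α : ℕ) + 1) (a - 1) : ℕ) := by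
    simp only [bigN_sub_single, Finset.sum_sub_distrib]
    rw [← Finset.sum_filter, Finset.sum_const, nsmul_eq_mul, mul_one]
    congr 2
    have e2 : (Finset.filter (fun m => m ≤ α)
        (Finset.filter (fun i : Fin k => a ≤ i.val + 1) Finset.univ)).map Fin.valEmbedding
        = Finset.Ico (a - 1) (α + 1) := by
      ext m
      simp only [Finset.mem_map, Finset.mem_filter, Finset.mem_univ, true_and,
        Fin.valEmbedding_apply, Finset.mem_Ico]
      constructor
      · rintro ⟨i, ⟨h1, h2⟩, rfl⟩
        have : (i : ℕ) ≤ α := h2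
        omega
      · rintro ⟨h1, h2⟩
        exact ⟨⟨m, by omega⟩, ⟨by simp; omega, Fin.le_def.2 (by simp; omega)⟩, rfl⟩
    rw [← Finset.card_map, e2, Nat.card_Ico]
    omega
  rw [qExponent, qExponent, h1, h2]
  push_cast [Nat.cast_sub (min_le_left ((α : ℕ) + 1) (a - 1))]
  ring

/-- Pascal's rule in the factor α. The weighted part is a summand at n - e_α once M is lowered by
twice the α-th column of T⁻¹, since this keeps every M_j - 2(N_1 + ⋯ + N_j). -/
theorem fermionicTerm_recurrence (hq0 : q ≠ 0) (hq1 : ∀ n : ℕ, 0 < n → q ^ n ≠ 1) {a : ℕ}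
    (ha : 1 ≤ a) (M n : Fin k → ℤ) (α : Fin k) :
    fermionicTerm q a M n = fermionicTerm q a (M - Pi.single α 1) n
      + q ^ (M α - ((min ((α : ℕ) + 1) (a - 1) : ℕ) : ℤ))
        * fermionicTerm q a (fun j => M j - 2 * ((min ((j : ℕ) + 1) (α + 1) : ℕ) : ℤ))
          (n - Pi.single α 1) := by
  simp only [fermionicTerm]
  have e : ∀ j : Fin k, M j - 2 * ((min ((j : ℕ) + 1) (α + 1) : ℕ) : ℤ)
      - xExponent (n - Pi.single α 1) j = M j - xExponent n j := fun j => by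
    rw [xExponent_sub_single]; ring
  have e' : ∀ j : Fin k, M j - 2 * ((min ((j : ℕ) + 1) (α + 1) : ℕ) : ℤ)
      + (n - Pi.single α 1 : Fin k → ℤ) j - xExponent (n - Pi.single α 1) j
      = M j + (n - Pi.single α 1 : Fin k → ℤ) j - xExponent n j := fun j => by
    have := e j
    linarith
  simp only [e, e']
  have hsplit : ∀ f : Fin k → K, ∏ j, f j = f α * ∏ j ∈ Finset.univ.erase α, f j :=
    fun f => (Finset.mul_prod_erase _ f (Finset.mem_univ α)).symm
  rw [hsplit, hsplit, hsplit]
  have p1 : ∏ j ∈ Finset.univ.erase α, qBin q ((M - Pi.single α 1 : Fin k → ℤ) j + n j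
      - xExponent n j) ((M - Pi.single α 1 : Fin k → ℤ) j - xExponent n j)
      = ∏ j ∈ Finset.univ.erase α, qBin q (M j + n j - xExponent n j) (M j - xExponent n j) :=
    Finset.prod_congr rfl fun j hj => by
      simp [Pi.single_eq_of_ne (Finset.ne_of_mem_erase hj)]
  have p2 : ∏ j ∈ Finset.univ.erase α, qBin q (M j + (n - Pi.single α 1 : Fin k → ℤ) j
      - xExponent n j) (M j - xExponent n j)
      = ∏ j ∈ Finset.univ.erase α, qBin q (M j + n j - xExponent n j) (M j - xExponent n j) :=
    Finset.prod_congr rfl fun j hj => by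
      simp [Pi.single_eq_of_ne (Finset.ne_of_mem_erase hj)]
  rw [p1, p2]
  simp only [Pi.sub_apply, Pi.single_eq_same]
  have hp := qBin_pascal hq0 hq1 (M α + n α - xExponent n α - 1) (M α - xExponent n α)
  rw [sub_add_cancel] at hp
  rw [hp, show M α - 1 + n α - xExponent n α = M α + n α - xExponent n α - 1 by ring,
    show M α - 1 - xExponent n α = M α - xExponent n α - 1 by ring,
    show M α + (n α - 1) - xExponent n α = M α + n α - xExponent n α - 1 by ring]
  have hx : q ^ qExponent a n * q ^ (M α - xExponent n α)
      = q ^ (M α - ((min ((α : ℕ) + 1) (a - 1) : ℕ) : ℤ))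
        * q ^ qExponent a (n - Pi.single α 1) := by
    rw [← zpow_add₀ hq0, ← zpow_add₀ hq0, qExponent_eq_sub_single ha n α]
    congr 1
    ring
  linear_combination (qBin q (M α + n α - xExponent n α - 1) (M α - xExponent n α)
    * ∏ j ∈ Finset.univ.erase α, qBin q (M j + n j - xExponent n j) (M j - xExponent n j)) * hx

end Fermionic

/-! ### The fermionic sum as a function of L. -/

section FermionicSum

variable {K : Type*} [Field K] {q : K} {k : ℕ}

/-- The vector `(L_1, …, L_{k-1}, L_k + L_{k+1})`. -/
def foldTail (k : ℕ) (L : ℕ → ℤ) : Fin k → ℤ :=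
  fun i => L (i + 1) + if (i : ℕ) + 1 = k then L (k + 1) else 0

/-- The vector `M` with `vecL a M = foldTail k L`. -/
def topVec (k a : ℕ) (L : ℕ → ℤ) : Fin k → ℤ := fun j =>
  ∑ i ∈ Finset.range (k + 2), ((min i (j + 1) : ℕ) : ℤ) * L i
    + ((min ((j : ℕ) + 1) (a - 1) : ℕ) : ℤ) - (j + 1)

theorem tadpole_mulVec_topVec {a : ℕ} (ha : 1 ≤ a) (hak : a ≤ k + 1) (L : ℕ → ℤ) (i : Fin k) :
    (tadpole k *ᵥ topVec k a L) i = foldTail k L i + unitVec k (a - 1) i - unitVec k k i := by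
  have hi := i.isLt
  -- Capping `n` at `k` provides the boundary condition w(k+1) = w(k) and changes nothing for the
  -- entries of `topVec`.
  have h := tadpole_mulVec (k := k) (fun n =>
    ∑ i ∈ Finset.range (k + 2), ((min i (min n k) : ℕ) : ℤ) * L i
      + ((min n (a - 1) : ℕ) : ℤ) - ((min n k : ℕ) : ℤ)) (by simp)
    (by
      rw [show min (k + 1) k = min k k by omega, show min (k + 1) (a - 1) = min k (a - 1) by omega])
    i
  have e : topVec k a L = fun j : Fin k => ∑ i ∈ Finset.range (k + 2),
      ((min i (min ((j : ℕ) + 1) k) : ℕ) : ℤ) * L i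
      + ((min ((j : ℕ) + 1) (a - 1) : ℕ) : ℤ) - ((min ((j : ℕ) + 1) k : ℕ) : ℤ) := by
    funext j
    have hj : min ((j : ℕ) + 1) k = j + 1 := by have := j.isLt; omega
    rw [hj, topVec]
    push_cast
    ring
  rw [e, h]
  have hs : 2 * ∑ c ∈ Finset.range (k + 2), ((min c (min ((i : ℕ) + 1) k) : ℕ) : ℤ) * L c
      - ∑ c ∈ Finset.range (k + 2), ((min c (min (i : ℕ) k) : ℕ) : ℤ) * L c
      - ∑ c ∈ Finset.range (k + 2), ((min c (min ((i : ℕ) + 2) k) : ℕ) : ℤ) * L c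
      = foldTail k L i := by
    have hc : ∀ c ∈ Finset.range (k + 2), 2 * (((min c (min ((i : ℕ) + 1) k) : ℕ) : ℤ) * L c)
        - ((min c (min (i : ℕ) k) : ℕ) : ℤ) * L c
        - ((min c (min ((i : ℕ) + 2) k) : ℕ) : ℤ) * L c
        = (if c = (i : ℕ) + 1 then L c else 0)
          + (if c = k + 1 then (if (i : ℕ) + 1 = k then L c else 0) else 0) := by
      intro c hc
      rw [Finset.mem_range] at hc
      have h1 : 2 * ((min c (min ((i : ℕ) + 1) k) : ℕ) : ℤ) - ((min c (min (i : ℕ) k) : ℕ) : ℤ)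
          - ((min c (min ((i : ℕ) + 2) k) : ℕ) : ℤ)
          = (if c = (i : ℕ) + 1 then 1 else 0)
          + (if c = k + 1 then (if (i : ℕ) + 1 = k then 1 else 0) else 0) := by
        split_ifs <;> omega
      calc _ = (2 * ((min c (min ((i : ℕ) + 1) k) : ℕ) : ℤ) - ((min c (min (i : ℕ) k) : ℕ) : ℤ)
          - ((min c (min ((i : ℕ) + 2) k) : ℕ) : ℤ)) * L c := by ring
        _ = _ := by rw [h1]; split_ifs <;> ring
    rw [Finset.mul_sum, ← Finset.sum_sub_distrib, ← Finset.sum_sub_distrib,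
      Finset.sum_congr rfl hc, Finset.sum_add_distrib, Finset.sum_ite_eq', Finset.sum_ite_eq',
      if_pos (by rw [Finset.mem_range]; omega), if_pos (by simp), foldTail]
  have h2 : 2 * ((min ((i : ℕ) + 1) (a - 1) : ℕ) : ℤ) - ((min (i : ℕ) (a - 1) : ℕ) : ℤ)
      - ((min ((i : ℕ) + 2) (a - 1) : ℕ) : ℤ) = unitVec k (a - 1) i := by
    simp only [unitVec]; split_ifs <;> omega
  have h3 : 2 * ((min ((i : ℕ) + 1) k : ℕ) : ℤ) - ((min (i : ℕ) k : ℕ) : ℤ)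
      - ((min ((i : ℕ) + 2) k : ℕ) : ℤ) = unitVec k k i := by
    simp only [unitVec]; split_ifs <;> omega
  linarith

theorem topVec_add_single (a : ℕ) (L : ℕ → ℤ) {i : ℕ} (hi : i < k + 2) (c : ℤ) (j : Fin k) :
    topVec k a (L + Pi.single i c) j
      = topVec k a L j + ((min i (j + 1) : ℕ) : ℤ) * c := by
  have : ∑ m ∈ Finset.range (k + 2), ((min m ((j : ℕ) + 1) : ℕ) : ℤ) * (Pi.single i c : ℕ → ℤ) m
      = ((min i (j + 1) : ℕ) : ℤ) * c := by
    rw [Finset.sum_eq_single i]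
    · simp
    · intro m _ hm; simp [hm]
    · simp; omega
  simp only [topVec, Pi.add_apply, mul_add, Finset.sum_add_distrib]
  rw [this]
  ring

/-- Keeps the fermionic sums finite even for the vectors with entries -1 that `mixed_recurrence`
passes through. -/
theorem neg_one_le_tadpole_mulVec_topVec {a : ℕ} (ha : 1 ≤ a) (hak : a ≤ k + 1) {L : ℕ → ℤ}
    (hn : ∀ i, 1 ≤ i → -1 ≤ L i) (hk : ∀ i, k ≤ i → 0 ≤ L i) (i : Fin k) :
    -1 ≤ (tadpole k *ᵥ topVec k a L) i := by
  rw [tadpole_mulVec_topVec ha hak]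
  have h1 := hn (i + 1) (by omega)
  have h2 : 0 ≤ unitVec k (a - 1) i := by
    simp only [unitVec]; split_ifs <;> omega
  have h5 : unitVec k k i = if (i : ℕ) + 1 = k then 1 else 0 := rfl
  rw [h5, foldTail]
  split_ifs with h
  · have h3 := hk (i + 1) (by omega)
    have h4 := hk (k + 1) (by omega)
    omega
  · omega

/-- After folding, 2e_A - e_{A-1} - e_{A+1} is T e_A, so lowering M_A by one turns 2e_A into e_{A-1}
+ e_{A+1}; lowering M by 2T⁻¹e_A removes 2e_A. -/
theorem fermionic_quadratic_recurrence (hq0 : q ≠ 0) (hq1 : ∀ n : ℕ, 0 < n → q ^ n ≠ 1) {a : ℕ}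
    (ha : 1 ≤ a) (hak : a ≤ k + 1) (A : ℕ) (L : ℕ → ℤ) (hA : 1 ≤ A) (hAk : A ≤ k)
    (hn : ∀ i, 1 ≤ i → -1 ≤ L i) (hk : ∀ i, k ≤ i → 0 ≤ L i) :
    ∑ᶠ n, fermionicTerm q a (topVec k a (L + Pi.single A 2)) n
      = ∑ᶠ n, fermionicTerm q a (topVec k a (L + Pi.single (A - 1) 1 + Pi.single (A + 1) 1)) n
        + q ^ (A + ∑ i ∈ Finset.range (k + 2), (min i A : ℕ) * L i)
          * ∑ᶠ n, fermionicTerm q a (topVec k a L) n := by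
  have single_nonneg : ∀ j i : ℕ, 0 ≤ (Pi.single j 1 : ℕ → ℤ) i := fun j i => by
    rw [Pi.single_apply]; split_ifs <;> norm_num
  obtain ⟨α, hαA⟩ : ∃ α : Fin k, (α : ℕ) + 1 = A :=
    ⟨⟨A - 1, by omega⟩, Nat.sub_add_cancel hA⟩
  have e1 : topVec k a (L + Pi.single A 2) - Pi.single α 1
      = topVec k a (L + Pi.single (A - 1) 1 + Pi.single (A + 1) 1) := by
    funext j
    rw [Pi.sub_apply, topVec_add_single _ _ (by omega), topVec_add_single _ _ (by omega),
      topVec_add_single _ _ (by omega), Pi.single_apply]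
    have : j = α ↔ (j : ℕ) + 1 = A := by rw [Fin.ext_iff]; omega
    simp only [this]
    split_ifs <;> omega
  have e2 : (fun j : Fin k => topVec k a (L + Pi.single A 2) j
      - 2 * ((min ((j : ℕ) + 1) (α + 1) : ℕ) : ℤ)) = topVec k a L := by
    funext j
    rw [topVec_add_single _ _ (by omega), hαA]
    omega
  have e3 : topVec k a (L + Pi.single A 2) α - ((min ((α : ℕ) + 1) (a - 1) : ℕ) : ℤ)
      = A + ∑ i ∈ Finset.range (k + 2), ((min i A : ℕ) : ℤ) * L i := by
    rw [topVec_add_single _ _ (by omega), topVec, hαA]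
    have : ((α : ℕ) : ℤ) + 1 = A := by exact_mod_cast hαA
    rw [this, min_self]
    ring
  have f1 := finite_support_fermionicTerm hq0 a (neg_one_le_tadpole_mulVec_topVec ha hak hn hk)
  have f2 := finite_support_fermionicTerm hq0 a (neg_one_le_tadpole_mulVec_topVec ha hak
    (L := L + Pi.single (A - 1) 1 + Pi.single (A + 1) 1)
    (fun i hi => by
      have := hn i hi
      have := single_nonneg (A - 1) i
      have := single_nonneg (A + 1) i
      simp only [Pi.add_apply]
      omega)
    (fun i hi => by
      have := hk i hi
      have := single_nonneg (A - 1) i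
      have := single_nonneg (A + 1) i
      simp only [Pi.add_apply]
      omega))
  have hshift : ∑ᶠ n, fermionicTerm q a (topVec k a L) (n - Pi.single α 1)
      = ∑ᶠ n, fermionicTerm q a (topVec k a L) n :=
    finsum_sub_right (fun n : Fin k → ℤ => fermionicTerm q a (topVec k a L) n) (Pi.single α 1)
  have f3 : (Function.support fun n : Fin k → ℤ => fermionicTerm q a (topVec k a L)
      (n - Pi.single α 1)).Finite :=
    finite_support_sub_right _ f1
  rw [← hshift, mul_finsum, ← finsum_add_distrib f2 (finite_support_const_mul _ f3)]
  refine finsum_congr fun n => ?_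
  rw [fermionicTerm_recurrence hq0 hq1 ha _ n α, e1, e2, e3]

/-- Here M_1 ≤ 1 while 2n_i ≤ 2N_1 ≤ M_1, so only n = 0 survives. Its product of `[M_j; M_j]` is 1
unless some M_j is negative, which is decided by M_k = B + a - 1 - k. -/
theorem fermionic_single (hq0 : q ≠ 0) (hq1 : ∀ n : ℕ, 0 < n → q ^ n ≠ 1) {a : ℕ}
    (hk : 1 ≤ k) (ha : 1 ≤ a) (hak : a ≤ k + 1) {B : ℕ} (hB : B ≤ k) :
    ∑ᶠ n, fermionicTerm q a (topVec k a (Pi.single B 1)) n = if k + 1 ≤ B + a then 1 else 0 := by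
  have hM : ∀ j : Fin k, topVec k a (Pi.single B 1) j
      = ((min B (j + 1) : ℕ) : ℤ) + ((min ((j : ℕ) + 1) (a - 1) : ℕ) : ℤ) - (j + 1) := by
    intro j
    have := topVec_add_single (k := k) a 0 (show B < k + 2 by omega) 1 j
    rw [zero_add] at this
    rw [this, topVec]
    simp
    ring
  have single_nonneg : ∀ i : ℕ, 0 ≤ (Pi.single B 1 : ℕ → ℤ) i := fun i => by
    rw [Pi.single_apply]; split_ifs <;> norm_num
  have hT := neg_one_le_tadpole_mulVec_topVec ha hak (L := Pi.single B 1)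
    (fun i _ => by have := single_nonneg i; omega) (fun i _ => single_nonneg i)
  rw [finsum_eq_single _ 0]
  · have h0 : fermionicTerm q a (topVec k a (Pi.single B 1)) 0
        = ∏ j, qBin q (topVec k a (Pi.single B 1) j) (topVec k a (Pi.single B 1) j) := by
      simp [fermionicTerm, qExponent, xExponent, bigN]
    rw [h0]
    split_ifs with h
    · refine Finset.prod_eq_one fun j _ => qBin_self hq1 ?_
      have := j.isLt
      rw [hM]
      omega
    · refine Finset.prod_eq_zero (Finset.mem_univ ⟨k - 1, by omega⟩) (qBin_of_neg _ ?_)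
      rw [hM]
      simp only
      omega
  · intro n hn
    by_contra h
    obtain ⟨h1, h2⟩ := nonneg_of_fermionicTerm_ne_zero hq0 hT h
    refine hn (funext fun i => ?_)
    have h3 := le_xExponent h1 i ⟨0, by omega⟩ (Nat.zero_le _)
    have h4 := h2 ⟨0, by omega⟩
    rw [hM] at h4
    simp only at h4
    have := h1 i
    simp only [Pi.zero_apply]
    omega

end FermionicSum

/-! ### Supernomial coefficients: recurrences, symmetry, and reduction of the number of entries. -/

section Supernomials

variable {K : Type*} [Field K] {q : K}

/-- The entry after the `i`-th one in `j = (j_1, …, j_N)`, with `j_{N+1} = t`. -/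
def nextEntryOr {N : ℕ} (t : ℤ) (j : Fin N → ℕ) (i : Fin N) : ℤ :=
  if h : (i : ℕ) + 1 < N then (j ⟨(i : ℕ) + 1, h⟩ : ℤ) else t

theorem nextEntryOr_zero {N : ℕ} (j : Fin N → ℕ) (i : Fin N) :
    nextEntryOr 0 j i = (nextEntry j i : ℤ) := by
  rw [nextEntryOr, nextEntry]
  split_ifs <;> simp

theorem nextEntryOr_snoc_castSucc {N : ℕ} (t : ℤ) (j : Fin N → ℕ) (x : ℕ) (i : Fin N) :
    nextEntryOr t (Fin.snoc (α := fun _ => ℕ) j x) i.castSucc = nextEntryOr x j i := by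
  have hi := i.isLt
  rw [nextEntryOr, nextEntryOr, dif_pos (by simp)]
  split_ifs with h
  · exact congrArg _ (Fin.snoc_castSucc (α := fun _ => ℕ) (p := j) (x := x)
      (i := ⟨(i : ℕ) + 1, h⟩))
  · have e : (⟨(i.castSucc : ℕ) + 1, by simp⟩ : Fin (N + 1)) = Fin.last N := by
      ext; simp; omega
    rw [e, Fin.snoc_last]

theorem nextEntryOr_last {N : ℕ} (t : ℤ) (j : Fin (N + 1) → ℕ) :
    nextEntryOr t j (Fin.last N) = t := by
  rw [nextEntryOr, dif_neg (by simp)]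

/-- The summand of the supernomial coefficient for `(L_1, …, L_N)`, but with `j_{N+1} = t`. -/
noncomputable def weightedTerm (q : K) (L : ℕ → ℤ) (N : ℕ) (t : ℤ) (j : Fin N → ℕ) : K :=
  q ^ (∑ i, (j i : ℤ) * ((∑ m ∈ Finset.Ioi i, L (m + 1)) - nextEntryOr t j i))
    * ∏ i : Fin N, qBin q (L (i + 1) + nextEntryOr t j i) (j i : ℤ)

theorem weightedTerm_zero (L : ℕ → ℤ) {N : ℕ} (j : Fin N → ℕ) :
    weightedTerm q L N 0 j = supernomialTerm q (fun i : Fin N => L (i + 1)) j := by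
  simp only [weightedTerm, supernomialTerm, nextEntryOr_zero]

theorem weightedTerm_snoc (hq0 : q ≠ 0) (L : ℕ → ℤ) {N : ℕ} (t : ℤ) (j : Fin N → ℕ) (x : ℕ) :
    weightedTerm q L (N + 1) t (Fin.snoc (α := fun _ => ℕ) j x)
      = q ^ (L (N + 1) * ∑ i, (j i : ℤ) - x * t) * qBin q (L (N + 1) + t) x
        * weightedTerm q L N x j := by
  have hsum : ∀ i : Fin N, ∑ m ∈ Finset.Ioi i.castSucc, L ((m : ℕ) + 1)
      = ∑ m ∈ Finset.Ioi i, L ((m : ℕ) + 1) + L (N + 1) := by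
    intro i
    rw [← Finset.filter_lt_eq_Ioi, ← Finset.filter_lt_eq_Ioi, Finset.sum_filter,
      Finset.sum_filter, Fin.sum_univ_castSucc]
    simp [Fin.castSucc_lt_last]
  have hlast : ∑ m ∈ Finset.Ioi (Fin.last N), L ((m : ℕ) + 1) = 0 :=
    Finset.sum_eq_zero fun m hm => absurd (Finset.mem_Ioi.1 hm) (not_lt.2 (Fin.le_last m))
  rw [weightedTerm, weightedTerm, Fin.sum_univ_castSucc, Fin.prod_univ_castSucc]
  simp only [Fin.snoc_castSucc, Fin.snoc_last, nextEntryOr_snoc_castSucc, nextEntryOr_last, hsum,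
    hlast, Fin.val_castSucc, Fin.val_last]
  have e : q ^ (∑ i, (j i : ℤ) * (∑ m ∈ Finset.Ioi i, L ((m : ℕ) + 1) + L (N + 1)
        - nextEntryOr x j i) + (x : ℤ) * (0 - t))
      = q ^ (L (N + 1) * ∑ i, (j i : ℤ) - x * t)
        * q ^ (∑ i, (j i : ℤ) * (∑ m ∈ Finset.Ioi i, L ((m : ℕ) + 1) - nextEntryOr x j i)) := by
    rw [← zpow_add₀ hq0, Finset.mul_sum, sub_add_eq_add_sub, ← Finset.sum_add_distrib]
    congr 1
    rw [zero_sub, mul_neg, ← sub_eq_add_neg]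
    congr 1
    exact Finset.sum_congr rfl fun i _ => by ring
  rw [e]
  ring

theorem finsum_int_eq_finsum_nat {f : ℤ → K} (hf : ∀ j < 0, f j = 0) :
    ∑ᶠ j, f j = ∑ᶠ n : ℕ, f n := by
  rw [← finsum_mem_range (f := f) (g := fun n : ℕ => (n : ℤ)) Nat.cast_injective]
  refine finsum_congr fun j => ?_
  rcases lt_or_ge j 0 with h | h
  · rw [hf j h]; simp
  · classical rw [finsum_eq_if, if_pos ⟨j.toNat, by simp [h]⟩]

theorem finite_support_sum_eq {N : ℕ} (J : ℤ) (f : (Fin N → ℕ) → K) :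
    (Function.support fun j : Fin N → ℕ => if ∑ i, (j i : ℤ) = J then f j else 0).Finite := by
  refine (Set.finite_Icc (0 : Fin N → ℕ) (fun _ => J.toNat)).subset fun j hj => ?_
  have h : ∑ i, (j i : ℤ) = J := by
    by_contra h
    exact hj (if_neg h)
  refine ⟨fun i => Nat.zero_le _, fun i => ?_⟩
  have : (j i : ℤ) ≤ ∑ i, (j i : ℤ) :=
    Finset.single_le_sum (f := fun i => (j i : ℤ)) (fun i _ => Int.natCast_nonneg _)
      (Finset.mem_univ i)
  show j i ≤ J.toNat
  omega

/-- Summing over the last variable first reproduces the recursion of `partialSum`; the value of that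
variable is the parameter `t` of the shorter sum. -/
theorem finsum_weightedTerm (hq0 : q ≠ 0) (L : ℕ → ℤ) (N : ℕ) (t J : ℤ) :
    ∑ᶠ j : Fin N → ℕ, (if ∑ i, (j i : ℤ) = J then weightedTerm q L N t j else 0)
      = q ^ (L N * J) * partialSum q L N (L N + t) J := by
  induction N generalizing t J with
  | zero =>
    rw [finsum_unique, partialSum_zero]
    by_cases h : J = 0
    · simp [h, weightedTerm]
    · simp [h, Ne.symm h]
  | succ N ih =>
    rw [← finsum_comp_equiv (Fin.snocEquiv fun _ : Fin (N + 1) => ℕ), finsum_curry]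
    · rw [partialSum_succ, mul_finsum, finsum_int_eq_finsum_nat fun j hj => by
        rw [qBin_of_neg _ hj]; simp]
      refine finsum_congr fun x => ?_
      have h := ih x (J - x)
      have e : q ^ (L (N + 1) * J) * q ^ (L N * (J - x) - x * (L (N + 1) + t))
          = q ^ (L (N + 1) * (J - x) - x * t) * q ^ (L N * (J - x)) := by
        rw [← zpow_add₀ hq0, ← zpow_add₀ hq0]; congr 1; ring
      rw [← mul_assoc, ← mul_assoc, e, mul_right_comm _ (q ^ (L N * (J - x))), mul_assoc _ _
        (partialSum q L N _ _), ← h, mul_finsum]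
      refine finsum_congr fun j => ?_
      have hs : Fin.snocEquiv (fun _ : Fin (N + 1) => ℕ) (x, j)
          = Fin.snoc (α := fun _ => ℕ) j x := rfl
      rw [hs, weightedTerm_snoc hq0, Fin.sum_univ_castSucc]
      simp only [Fin.snoc_castSucc, Fin.snoc_last]
      by_cases hj : ∑ i, (j i : ℤ) = J - x
      · rw [if_pos (by omega), if_pos hj, hj]
      · rw [if_neg (by omega), if_neg hj, mul_zero]
    · exact (finite_support_sum_eq J _).preimage (Equiv.injective _).injOn

/-- The supernomial coefficient for `(L_1, …, L_N)`. -/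
noncomputable def supernomial (q : K) (N : ℕ) (L : ℕ → ℤ) (c : ℚ) : K :=
  qSupernomial q (fun i : Fin N => L (i + 1)) c

theorem ellLast_restrict (N : ℕ) (L : ℕ → ℤ) :
    ellLast (fun i : Fin N => L (i + 1)) = ∑ i ∈ Finset.range (N + 1), (i : ℤ) * L i := by
  rw [ellLast_eq, Fin.sum_univ_eq_sum_range (fun i : ℕ => ((i : ℤ) + 1) * L (i + 1)),
    Finset.sum_range_succ']
  simp

/-- An extra layer with `x = 0` forces its variable to be 0 and supplies exactly the missing factor
`q^(L_N J)`. -/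
theorem supernomial_eq (hq0 : q ≠ 0) {N : ℕ} {L : ℕ → ℤ} {c : ℚ} {J : ℤ}
    (h : c + ((∑ i ∈ Finset.range (N + 1), (i : ℤ) * L i : ℤ) : ℚ) / 2 = J) :
    supernomial q N L c = partialSum q L (N + 1) 0 J := by
  rw [supernomial, qSupernomial, ellLast_restrict, h, partialSum_succ_zero hq0]
  have := finsum_weightedTerm hq0 L N 0 J
  rw [add_zero] at this
  rw [← this]
  refine finsum_congr fun j => ?_
  rw [finsum_eq_if, weightedTerm_zero]
  congr 1
  push_cast
  rw [← Int.cast_inj (α := ℚ)]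
  push_cast
  rfl

theorem supernomial_eq_zero {N : ℕ} {L : ℕ → ℤ} {c : ℚ}
    (h : ∀ J : ℤ, c + ((∑ i ∈ Finset.range (N + 1), (i : ℤ) * L i : ℤ) : ℚ) / 2 ≠ J) :
    supernomial q N L c = 0 := by
  rw [supernomial, qSupernomial, ellLast_restrict, ← finsum_zero (α := Fin N → ℕ)]
  refine finsum_congr fun j => ?_
  rw [finsum_eq_if, if_neg]
  intro h'
  exact h (∑ i, j i : ℕ) (by rw [← h']; simp)

theorem sum_range_mul_add_single (N : ℕ) (f : ℕ → ℤ) (L : ℕ → ℤ) {m : ℕ} (hm : m < N + 1) (c : ℤ) :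
    ∑ i ∈ Finset.range (N + 1), f i * (L + Pi.single m c : ℕ → ℤ) i
      = ∑ i ∈ Finset.range (N + 1), f i * L i + f m * c := by
  simp only [Pi.add_apply, mul_add, Finset.sum_add_distrib]
  congr 1
  rw [Finset.sum_eq_single m]
  · simp
  · intro i _ hi; simp [hi]
  · simp; omega

/-- Adding 2e_A or e_{A-1} + e_{A+1} raises ℓ_N by 2A, so a fixed `c` means J + A for these terms
against J for L. -/
theorem supernomial_quadratic_recurrence (hq0 : q ≠ 0) (hq1 : ∀ n : ℕ, 0 < n → q ^ n ≠ 1) {N A : ℕ}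
    (L : ℕ → ℤ) (hA : 1 ≤ A) (hAN : A < N) (c : ℚ) :
    supernomial q N (L + Pi.single A 2) c
      = supernomial q N (L + Pi.single (A - 1) 1 + Pi.single (A + 1) 1) c
        + q ^ (A + ∑ i ∈ Finset.range (N + 1), (min i A : ℕ) * L i) * supernomial q N L c := by
  have s1 := sum_range_mul_add_single N (fun i => (i : ℤ)) L (show A < N + 1 by omega) 2
  have s2 := sum_range_mul_add_single N (fun i => (i : ℤ)) L (show A - 1 < N + 1 by omega) 1
  have s3 := sum_range_mul_add_single N (fun i => (i : ℤ)) (L + Pi.single (A - 1) 1)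
    (show A + 1 < N + 1 by omega) 1
  rw [s2] at s3
  push_cast [Nat.cast_sub hA] at s3
  set l := ∑ i ∈ Finset.range (N + 1), (i : ℤ) * L i with hl
  by_cases h : ∃ J : ℤ, c + (l : ℚ) / 2 = J
  · obtain ⟨J, hJ⟩ := h
    rw [supernomial_eq hq0 (J := J + A) (by rw [s1]; push_cast; rw [← hJ]; ring),
      supernomial_eq hq0 (J := J + A) (by rw [s3]; push_cast; rw [← hJ]; ring),
      supernomial_eq hq0 hJ]
    obtain ⟨n, rfl⟩ : ∃ n, A = n + 1 := ⟨A - 1, by omega⟩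
    obtain ⟨m, rfl⟩ : ∃ m, N = n + 2 + m := ⟨N - n - 2, by omega⟩
    have := partialSum_add_single_two hq0 hq1 L n m 0 (J + (n + 1 : ℕ))
    rw [add_sub_cancel_right] at this
    rw [show n + 2 + m + 1 = n + 3 + m by ring]
    exact this
  · push Not at h
    rw [supernomial_eq_zero h, supernomial_eq_zero, supernomial_eq_zero, mul_zero, add_zero]
    · intro J hJ
      refine h (J - A) ?_
      rw [s3] at hJ
      push_cast at hJ ⊢
      rw [← hJ]; ring
    · intro J hJ
      refine h (J - A) ?_
      rw [s1] at hJ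
      push_cast at hJ ⊢
      rw [← hJ]; ring

theorem supernomial_congr {N : ℕ} {L L' : ℕ → ℤ} (h : ∀ i, 1 ≤ i → i ≤ N → L i = L' i) (c : ℚ) :
    supernomial q N L c = supernomial q N L' c := by
  rw [supernomial, supernomial]
  congr 1
  funext i
  exact h _ (by omega) (by have := i.isLt; omega)

theorem supernomial_mixed_recurrence (hq0 : q ≠ 0) (hq1 : ∀ n : ℕ, 0 < n → q ^ n ≠ 1) {k A B : ℕ}
    {L : ℕ → ℤ} (hA : 1 ≤ A) (hAB : A ≤ B) (hB : B ≤ k) (hL : ∀ i, 0 ≤ L i)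
    (hz : ∀ i, 1 ≤ i → i < B → L i = 0) (c : ℚ) :
    supernomial q (k + 1) (L + Pi.single A 1 + Pi.single B 1) c
      = supernomial q (k + 1) (L + Pi.single (A - 1) 1 + Pi.single (B + 1) 1) c
        + q ^ (A * (∑ i ∈ Finset.Icc 1 (k + 1), L i + 1))
          * supernomial q (k + 1) (L + Pi.single (B - A) 1) c :=
  mixed_recurrence hq0 (G := fun L => supernomial q (k + 1) L c)
    (fun L => supernomial_congr (fun i hi _ => by simp [show i ≠ 0 by omega]) c)
    (fun A L hA hAk _ _ => supernomial_quadratic_recurrence hq0 hq1 L hA (by omega) c)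
    A B L hA hAB hB hz (fun i _ => by have := hL i; omega) fun i _ => hL i

theorem supernomial_neg (hq0 : q ≠ 0) (hq1 : ∀ n : ℕ, 0 < n → q ^ n ≠ 1) {N : ℕ} {L : ℕ → ℤ}
    (hL : ∀ i, 0 ≤ L i) (c : ℚ) : supernomial q N L (-c) = supernomial q N L c := by
  by_cases h : ∃ J : ℤ, c + ((∑ i ∈ Finset.range (N + 1), (i : ℤ) * L i : ℤ) : ℚ) / 2 = J
  · obtain ⟨J, hJ⟩ := h
    rw [supernomial_eq hq0 hJ, supernomial_eq hq0
      (J := ∑ i ∈ Finset.range (N + 1), (i : ℤ) * L i - J)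
      (by rw [Int.cast_sub, ← hJ]; ring)]
    simpa using partialSum_symm hq0 hq1 (n := N + 1) (fun i _ => hL i) 0 J
  · push Not at h
    rw [supernomial_eq_zero h, supernomial_eq_zero]
    intro J hJ
    refine h (∑ i ∈ Finset.range (N + 1), (i : ℤ) * L i - J) ?_
    rw [Int.cast_sub, ← hJ]; ring

theorem abs_le_of_supernomial_ne_zero (hq0 : q ≠ 0) {N : ℕ} {L : ℕ → ℤ} (hL : ∀ i, 0 ≤ L i) {c : ℚ}
    (h : supernomial q N L c ≠ 0) :
    |c| ≤ ((∑ i ∈ Finset.range (N + 1), (i : ℤ) * L i : ℤ) : ℚ) / 2 := by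
  by_contra hc
  refine h ?_
  by_cases h : ∃ J : ℤ, c + ((∑ i ∈ Finset.range (N + 1), (i : ℤ) * L i : ℤ) : ℚ) / 2 = J
  · obtain ⟨J, hJ⟩ := h
    rw [supernomial_eq hq0 hJ]
    rw [not_le, lt_abs] at hc
    rcases hc with hc | hc
    · refine partialSum_eq_zero_of_lt hq0 (fun i _ => hL i) le_rfl ?_
      rw [mul_zero, add_zero, ← Int.cast_lt (R := ℚ), ← hJ]
      linarith
    · refine partialSum_of_neg _ _ _ ?_
      rw [← Int.cast_lt (R := ℚ), ← hJ, Int.cast_zero]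
      linarith
  · push Not at h
    exact supernomial_eq_zero h

theorem supernomial_succ_of_eq_zero (hq0 : q ≠ 0) {k : ℕ} {L : ℕ → ℤ} (hk : L (k + 1) = 0) (c : ℚ) :
    supernomial q (k + 1) L c = supernomial q k L c := by
  have hs : ∑ i ∈ Finset.range (k + 1 + 1), (i : ℤ) * L i
      = ∑ i ∈ Finset.range (k + 1), (i : ℤ) * L i := by
    rw [Finset.sum_range_succ, hk, mul_zero, add_zero]
  by_cases h : ∃ J : ℤ, c + ((∑ i ∈ Finset.range (k + 1), (i : ℤ) * L i : ℤ) : ℚ) / 2 = J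
  · obtain ⟨J, hJ⟩ := h
    rw [supernomial_eq hq0 hJ, supernomial_eq hq0 (J := J) (by rw [hs, hJ]),
      partialSum_succ_zero hq0, hk]
    simp
  · push Not at h
    rw [supernomial_eq_zero h, supernomial_eq_zero]
    intro J hJ
    exact h J (by rw [← hJ, hs])

/-- With last entry 1 the outer variable is 0 or 1. The difference formula at `x = 0` has a single
term, which is the coefficient with e_k; the other part has no unit vector left. -/
theorem supernomial_succ_add_single (hq0 : q ≠ 0) (hq1 : ∀ n : ℕ, 0 < n → q ^ n ≠ 1) {k : ℕ}
    {L : ℕ → ℤ} (hk : L (k + 1) = 0) {c : ℚ} {J : ℤ}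
    (hJ : c + ((∑ i ∈ Finset.range (k + 1), (i : ℤ) * L i + (k + 1) : ℤ) : ℚ) / 2 = J) :
    supernomial q (k + 1) (L + Pi.single (k + 1) 1) c
      = supernomial q k (L + Pi.single k 1) (c - 1 / 2)
        + q ^ J * supernomial q k L (c + (k + 1) / 2) := by
  have s1 := sum_range_mul_add_single (k + 1) (fun i => (i : ℤ)) L
    (show k + 1 < k + 1 + 1 by omega) 1
  have s2 := sum_range_mul_add_single k (fun i => (i : ℤ)) L (show k < k + 1 by omega) 1
  rw [Finset.sum_range_succ (fun i : ℕ => (i : ℤ) * L i), hk, mul_zero, add_zero] at s1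
  push_cast at hJ s1 s2
  rw [supernomial_eq hq0 (J := J) (by rw [s1, ← hJ]; push_cast; ring),
    supernomial_eq hq0 (J := J - 1) (by rw [s2, Int.cast_sub, ← hJ]; push_cast; ring),
    supernomial_eq hq0 (J := J) (by push_cast; rw [← hJ]; ring)]
  have c1 := partialSum_congr (q := q) (L := L + Pi.single (k + 1) 1) (L' := L) (n := k + 1)
    (fun i hi => by simp [hi.ne]) 1 J
  have c2 := partialSum_congr (q := q) (L := L + Pi.single k 1) (L' := L) (n := k)
    (fun i hi => by simp [hi.ne]) (L k + 1) (J - 1)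
  have e1 : (L + Pi.single (k + 1) 1 : ℕ → ℤ) (k + 1) = 1 := by simp [hk]
  have e2 : (L + Pi.single k 1 : ℕ → ℤ) k = L k + 1 := by simp
  rw [partialSum_succ_zero hq0, e1, c1, partialSum_succ_zero hq0 (L + Pi.single k 1), e2, c2]
  have h := partialSum_succ_add_one_sub hq0 hq1 L k 0 (J - 1)
  rw [sub_add_cancel, zero_add, finsum_eq_single _ 0 fun j hj => by
    rw [qBin_zero_left hq0, if_neg hj]; simp, qBin_zero_right] at h
  rw [sub_eq_iff_eq_add.1 h, one_mul]
  have e : q ^ ((L k + 1) * (J - 1)) = q ^ J * q ^ (L k * (J - 1 - 0) - (0 + 1) * 1) := by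
    rw [← zpow_add₀ hq0]; congr 1; ring
  rw [e, add_zero, sub_zero]
  ring

/-- When all entries are 0, each layer passes the argument 1 on and lowers J by one at the cost of
`q⁻¹`. -/
theorem partialSum_one_of_eq_zero (hq0 : q ≠ 0) (hq1 : ∀ n : ℕ, 0 < n → q ^ n ≠ 1) {L : ℕ → ℤ}
    {n : ℕ} (hL : ∀ i < n, L i = 0) {J : ℤ} (h0 : 0 ≤ J) (hJ : J ≤ n) :
    partialSum q L n 1 J = q ^ (-J) := by
  induction n generalizing J with
  | zero =>
    obtain rfl : J = 0 := by simp at hJ; omega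
    simp [partialSum_zero]
  | succ n ih =>
    have hLn := hL n (by omega)
    have hz : ∀ (m : ℕ) (J : ℤ), m ≤ n + 1 → partialSum q L m 0 J = if J = 0 then 1 else 0 := by
      intro m J hm
      induction m with
      | zero => rfl
      | succ m ihm =>
        rw [partialSum_succ_zero hq0, hL m (by omega), ihm (by omega)]
        simp
    have h := partialSum_succ_add_one_sub hq0 hq1 L n 0 (J - 1)
    rw [sub_add_cancel, zero_add, finsum_eq_single _ 0 fun j hj => by
      rw [qBin_zero_left hq0, if_neg hj]; simp, qBin_zero_right, hz _ _ le_rfl, hLn,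
      sub_eq_iff_eq_add] at h
    simp only [sub_zero, zero_mul, zero_add, zero_sub, mul_one] at h
    rw [h]
    rcases h0.eq_or_lt with rfl | hpos
    · rw [partialSum_of_neg _ _ _ (by norm_num)]
      simp
    · rw [ih (fun i hi => hL i (by omega)) (by omega) (by push_cast at hJ; omega),
        if_neg (by omega), add_zero, ← zpow_add₀ hq0]
      congr 1
      ring

theorem supernomial_single (hq0 : q ≠ 0) (hq1 : ∀ n : ℕ, 0 < n → q ^ n ≠ 1) {k B : ℕ} (hB : B ≤ k)
    {c : ℚ} {J : ℤ} (hJ : c + (B : ℚ) / 2 = J) (h0 : 0 ≤ J) (hJB : J ≤ B) :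
    supernomial q k (Pi.single B 1) c = 1 := by
  have s := sum_range_mul_add_single k (fun i => (i : ℤ)) 0 (show B < k + 1 by omega) 1
  simp only [zero_add, Pi.zero_apply, mul_zero, Finset.sum_const_zero, mul_one] at s
  rw [supernomial_eq hq0 (J := J) (by rw [s, ← hJ]; push_cast; rfl)]
  have h : ∀ m, partialSum q (Pi.single B 1) (B + m + 1) 0 J
      = partialSum q (Pi.single B 1) (B + 1) 0 J := by
    intro m
    induction m with
    | zero => rfl
    | succ m ih =>
      have : (Pi.single B 1 : ℕ → ℤ) (B + (m + 1)) = 0 := Pi.single_eq_of_ne (by omega) _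
      rw [partialSum_succ_zero hq0, this, zero_mul, zpow_zero, one_mul, ← add_assoc, ih]
  obtain ⟨m, rfl⟩ := Nat.exists_eq_add_of_le hB
  rw [h, partialSum_succ_zero hq0, Pi.single_eq_same, partialSum_one_of_eq_zero hq0 hq1
    (fun i hi => Pi.single_eq_of_ne hi.ne _) h0 hJB, one_mul, ← zpow_add₀ hq0, add_neg_cancel,
    zpow_zero]

end Supernomials

/-! ### The bosonic sum: folding e_{k+1} onto e_k, recurrences and initial values. -/

section Bosonic

variable {K : Type*} [Field K] {q : K} {k : ℕ}

/-- The bosonic sum with `s` in place of the supernomial coefficient. -/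
noncomputable def bosonicSum (q : K) (k a b : ℕ) (s : ℚ → K) : K :=
  ∑ᶠ j : ℤ, (q ^ (j * ((2 * k + 3) * (2 * j + 1) - 2 * a))
      * s (((b : ℚ) - a) / 2 + (2 * k + 3) * j)
    - q ^ ((2 * j + 1) * ((2 * k + 3) * j + a)) * s (((b : ℚ) + a) / 2 + (2 * k + 3) * j))

theorem finite_support_progression {s : ℚ → K} {D : ℚ} (hs : ∀ c, s c ≠ 0 → |c| ≤ D) (w : ℤ → K)
    (u : ℚ) :
    (Function.support fun j : ℤ => w j * s (u + (2 * k + 3) * j)).Finite := by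
  refine (Set.finite_Icc (-⌈D + |u|⌉) ⌈D + |u|⌉).subset fun j hj => ?_
  have h := abs_le.1 (hs _ (right_ne_zero_of_mul hj))
  have h1 := Int.le_ceil (D + |u|)
  have hu1 := le_abs_self u
  have hu2 := neg_abs_le u
  have hk : (0 : ℚ) ≤ k := Nat.cast_nonneg k
  have h0 : 0 ≤ D := (abs_nonneg _).trans (hs _ (right_ne_zero_of_mul hj))
  have h00 : 0 ≤ |u| := abs_nonneg u
  constructor
  · rw [← Int.cast_le (R := ℚ)]
    push_cast
    by_contra hlt
    push Not at hlt
    nlinarith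
  · rw [← Int.cast_le (R := ℚ)]
    by_contra hlt
    push Not at hlt
    nlinarith

theorem bosonicSum_eq_sub {s : ℚ → K} {D : ℚ} (hs : ∀ c, s c ≠ 0 → |c| ≤ D) (a b : ℕ) :
    bosonicSum q k a b s
      = ∑ᶠ j : ℤ, q ^ (j * ((2 * k + 3) * (2 * j + 1) - 2 * a))
          * s (((b : ℚ) - a) / 2 + (2 * k + 3) * j)
        - ∑ᶠ j : ℤ, q ^ ((2 * j + 1) * ((2 * k + 3) * j + a))
          * s (((b : ℚ) + a) / 2 + (2 * k + 3) * j) :=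
  finsum_sub_distrib (finite_support_progression hs _ _) (finite_support_progression hs _ _)

theorem finite_support_bosonicSum {s : ℚ → K} {D : ℚ} (hs : ∀ c, s c ≠ 0 → |c| ≤ D) (a b : ℕ) :
    (Function.support fun j : ℤ => q ^ (j * ((2 * k + 3) * (2 * j + 1) - 2 * a))
        * s (((b : ℚ) - a) / 2 + (2 * k + 3) * j)
      - q ^ ((2 * j + 1) * ((2 * k + 3) * j + a))
        * s (((b : ℚ) + a) / 2 + (2 * k + 3) * j)).Finite :=
  ((finite_support_progression hs _ _).union (finite_support_progression hs _ _)).subset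
    (Function.support_sub _ _)

theorem bosonicSum_add_mul {s t u : ℚ → K} {D D' : ℚ} (ht : ∀ c, t c ≠ 0 → |c| ≤ D)
    (hu : ∀ c, u c ≠ 0 → |c| ≤ D') (r : K) (h : ∀ c, s c = t c + r * u c) (a b : ℕ) :
    bosonicSum q k a b s = bosonicSum q k a b t + r * bosonicSum q k a b u := by
  rw [bosonicSum, bosonicSum, bosonicSum, mul_finsum, ← finsum_add_distrib
    (finite_support_bosonicSum ht a b)
    (finite_support_const_mul _ (finite_support_bosonicSum hu a b))]
  refine finsum_congr fun j => ?_
  rw [h, h]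
  ring

/-- The shift by 1/2 in `supernomial_succ_add_single` changes b from k + 2 to k + 1. The leftover
terms of the two halves are exchanged by j ↦ -1 - j together with c ↦ -c, and cancel. -/
theorem bosonicSum_fold_even (hq0 : q ≠ 0) (hq1 : ∀ n : ℕ, 0 < n → q ^ n ≠ 1) {L : ℕ → ℤ}
    (hL : ∀ i, 0 ≤ L i) (hk : L (k + 1) = 0) {a : ℕ}
    (hp : ¬ Even (∑ i ∈ Finset.range (k + 1), (i : ℤ) * L i + a)) :
    bosonicSum q k a (k + 2) (supernomial q (k + 1) (L + Pi.single (k + 1) 1))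
      = bosonicSum q k a (k + 1) (supernomial q k (L + Pi.single k 1)) := by
  have single_nonneg : ∀ j i : ℕ, 0 ≤ (Pi.single j 1 : ℕ → ℤ) i := fun j i => by
    rw [Pi.single_apply]; split_ifs <;> norm_num
  have hL1 : ∀ i, 0 ≤ (L + Pi.single k 1 : ℕ → ℤ) i :=
    fun i => add_nonneg (hL i) (single_nonneg k i)
  have hL2 : ∀ i, 0 ≤ (L + Pi.single (k + 1) 1 : ℕ → ℤ) i :=
    fun i => add_nonneg (hL i) (single_nonneg (k + 1) i)
  have hb := fun c => abs_le_of_supernomial_ne_zero (K := K) hq0 (N := k) hL1 (c := c)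
  have hb' := fun c => abs_le_of_supernomial_ne_zero (K := K) hq0 (N := k) hL (c := c)
  have hb'' := fun c => abs_le_of_supernomial_ne_zero (K := K) hq0 (N := k + 1) hL2 (c := c)
  rw [Int.not_even_iff_odd] at hp
  obtain ⟨n, hn⟩ := hp
  obtain ⟨m, hm⟩ : ∃ m : ℤ, 2 * m = 2 * k + 3 + ∑ i ∈ Finset.range (k + 1), (i : ℤ) * L i - a :=
    ⟨k + 2 + n - a, by rw [eq_sub_of_add_eq hn]; ring⟩
  have hmq : 2 * (m : ℚ) = 2 * k + 3 + ((∑ i ∈ Finset.range (k + 1), (i : ℤ) * L i : ℤ) : ℚ) - a :=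
    by exact_mod_cast hm
  have t1 : ∀ j : ℤ, supernomial q (k + 1) (L + Pi.single (k + 1) 1)
        ((((k + 2 : ℕ) : ℚ) - a) / 2 + (2 * k + 3) * j)
      = supernomial q k (L + Pi.single k 1) ((((k + 1 : ℕ) : ℚ) - a) / 2 + (2 * k + 3) * j)
        + q ^ (m + (2 * k + 3) * j)
          * supernomial q k L ((2 * k + 3 - a) / 2 + (2 * k + 3) * j) := by
    intro j
    rw [supernomial_succ_add_single hq0 hq1 hk (J := m + (2 * k + 3) * j)
      (by push_cast at hmq ⊢; linarith)]
    congr 3 <;> push_cast <;> ring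
  have t2 : ∀ j : ℤ, supernomial q (k + 1) (L + Pi.single (k + 1) 1)
        ((((k + 2 : ℕ) : ℚ) + a) / 2 + (2 * k + 3) * j)
      = supernomial q k (L + Pi.single k 1) ((((k + 1 : ℕ) : ℚ) + a) / 2 + (2 * k + 3) * j)
        + q ^ (m + a + (2 * k + 3) * j)
          * supernomial q k L ((2 * k + 3 + a) / 2 + (2 * k + 3) * j) := by
    intro j
    rw [supernomial_succ_add_single hq0 hq1 hk (J := m + a + (2 * k + 3) * j)
      (by push_cast at hmq ⊢; linarith)]
    congr 3 <;> push_cast <;> ring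
  have key : ∑ᶠ j : ℤ, q ^ ((2 * j + 1) * ((2 * k + 3) * j + a)) * q ^ (m + a + (2 * k + 3) * j)
          * supernomial q k L ((2 * k + 3 + a) / 2 + (2 * k + 3) * j)
      = ∑ᶠ j : ℤ, q ^ (j * ((2 * k + 3) * (2 * j + 1) - 2 * a)) * q ^ (m + (2 * k + 3) * j)
          * supernomial q k L ((2 * k + 3 - a) / 2 + (2 * k + 3) * j) := by
    rw [← finsum_comp_equiv (Equiv.subLeft (-1 : ℤ))]
    refine finsum_congr fun j => ?_
    rw [Equiv.subLeft_apply, ← supernomial_neg hq0 hq1 hL, ← zpow_add₀ hq0, ← zpow_add₀ hq0]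
    congr 2
    · ring
    · push_cast
      ring
  rw [bosonicSum_eq_sub hb'', bosonicSum_eq_sub hb]
  have distrib : ∀ x y z w : K, x * (y + z * w) = x * y + x * z * w := fun x y z w => by ring
  simp only [t1, t2, distrib]
  rw [finsum_add_distrib (finite_support_progression hb _ _) (finite_support_progression hb' _ _),
    finsum_add_distrib (finite_support_progression hb _ _) (finite_support_progression hb' _ _),
    key]
  ring

/-- As in the other parity, but b must grow, so the expansion is applied at -c; the leftover terms
now cancel under j ↦ -j. -/
theorem bosonicSum_fold_odd (hq0 : q ≠ 0) (hq1 : ∀ n : ℕ, 0 < n → q ^ n ≠ 1) {L : ℕ → ℤ}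
    (hL : ∀ i, 0 ≤ L i) (hk : L (k + 1) = 0) {a : ℕ}
    (hp : Even (∑ i ∈ Finset.range (k + 1), (i : ℤ) * L i + a)) :
    bosonicSum q k a (k + 1) (supernomial q (k + 1) (L + Pi.single (k + 1) 1))
      = bosonicSum q k a (k + 2) (supernomial q k (L + Pi.single k 1)) := by
  have single_nonneg : ∀ j i : ℕ, 0 ≤ (Pi.single j 1 : ℕ → ℤ) i := fun j i => by
    rw [Pi.single_apply]; split_ifs <;> norm_num
  have hL1 : ∀ i, 0 ≤ (L + Pi.single k 1 : ℕ → ℤ) i :=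
    fun i => add_nonneg (hL i) (single_nonneg k i)
  have hL2 : ∀ i, 0 ≤ (L + Pi.single (k + 1) 1 : ℕ → ℤ) i :=
    fun i => add_nonneg (hL i) (single_nonneg (k + 1) i)
  have hb := fun c => abs_le_of_supernomial_ne_zero (K := K) hq0 (N := k) hL1 (c := c)
  have hb' := fun c => abs_le_of_supernomial_ne_zero (K := K) hq0 (N := k) hL (c := c)
  have hb'' := fun c => abs_le_of_supernomial_ne_zero (K := K) hq0 (N := k + 1) hL2 (c := c)
  obtain ⟨m, hm⟩ := hp
  have hmq : ((∑ i ∈ Finset.range (k + 1), (i : ℤ) * L i : ℤ) : ℚ) + a = m + m := by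
    exact_mod_cast hm
  have t1 : ∀ j : ℤ, supernomial q (k + 1) (L + Pi.single (k + 1) 1)
        ((((k + 1 : ℕ) : ℚ) - a) / 2 + (2 * k + 3) * j)
      = supernomial q k (L + Pi.single k 1) ((((k + 2 : ℕ) : ℚ) - a) / 2 + (2 * k + 3) * j)
        + q ^ (m - (2 * k + 3) * j)
          * supernomial q k L (-a / 2 + (2 * k + 3) * j) := by
    intro j
    rw [← supernomial_neg hq0 hq1 hL2, ← supernomial_neg hq0 hq1 hL1, ← supernomial_neg hq0 hq1 hL,
      supernomial_succ_add_single hq0 hq1 hk (J := m - (2 * k + 3) * j)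
      (by push_cast at hmq ⊢; linarith)]
    congr 3 <;> push_cast <;> ring
  have t2 : ∀ j : ℤ, supernomial q (k + 1) (L + Pi.single (k + 1) 1)
        ((((k + 1 : ℕ) : ℚ) + a) / 2 + (2 * k + 3) * j)
      = supernomial q k (L + Pi.single k 1) ((((k + 2 : ℕ) : ℚ) + a) / 2 + (2 * k + 3) * j)
        + q ^ (m - a - (2 * k + 3) * j)
          * supernomial q k L (a / 2 + (2 * k + 3) * j) := by
    intro j
    rw [← supernomial_neg hq0 hq1 hL2, ← supernomial_neg hq0 hq1 hL1, ← supernomial_neg hq0 hq1 hL,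
      supernomial_succ_add_single hq0 hq1 hk (J := m - a - (2 * k + 3) * j)
      (by push_cast at hmq ⊢; linarith)]
    congr 3 <;> push_cast <;> ring
  have key : ∑ᶠ j : ℤ, q ^ ((2 * j + 1) * ((2 * k + 3) * j + a)) * q ^ (m - a - (2 * k + 3) * j)
          * supernomial q k L (a / 2 + (2 * k + 3) * j)
      = ∑ᶠ j : ℤ, q ^ (j * ((2 * k + 3) * (2 * j + 1) - 2 * a)) * q ^ (m - (2 * k + 3) * j)
          * supernomial q k L (-a / 2 + (2 * k + 3) * j) := by
    rw [← finsum_comp_equiv (Equiv.neg ℤ)]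
    refine finsum_congr fun j => ?_
    rw [Equiv.neg_apply, ← supernomial_neg hq0 hq1 hL, ← zpow_add₀ hq0, ← zpow_add₀ hq0]
    congr 2
    · ring
    · push_cast
      ring
  rw [bosonicSum_eq_sub hb'', bosonicSum_eq_sub hb]
  have distrib : ∀ x y z w : K, x * (y + z * w) = x * y + x * z * w := fun x y z w => by ring
  simp only [t1, t2, distrib]
  rw [finsum_add_distrib (finite_support_progression hb _ _) (finite_support_progression hb' _ _),
    finsum_add_distrib (finite_support_progression hb _ _) (finite_support_progression hb' _ _),
    key]
  ring

theorem foldTail_of_eq_zero {L : ℕ → ℤ} (hk : L (k + 1) = 0) :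
    foldTail k L = fun i : Fin k => L (i + 1) := by
  funext i
  simp [foldTail, hk]

theorem parityB_foldTail {L : ℕ → ℤ} (hk : L (k + 1) = 0) (a : ℕ) :
    parityB k a (foldTail k L)
      = if Odd (∑ i ∈ Finset.range (k + 1), (i : ℤ) * L i + a + k) then k + 1 else k + 2 := by
  rw [parityB, foldTail_of_eq_zero hk, ellLast_restrict]

theorem finsum_bosonicTerm {L : ℕ → ℤ} (hk : L (k + 1) = 0) (a : ℕ) :
    ∑ᶠ j, bosonicTerm q a (parityB k a (foldTail k L)) (foldTail k L) j
      = bosonicSum q k a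
        (if Odd (∑ i ∈ Finset.range (k + 1), (i : ℤ) * L i + a + k) then k + 1 else k + 2)
        (supernomial q k L) := by
  rw [parityB_foldTail hk, foldTail_of_eq_zero hk]
  rfl

/-- The indices of the added units sum to A + B, A + B and B - A, all of one parity, so the same b
serves all terms and the supernomial recurrence can be summed over j. -/
theorem bosonic_mixed_recurrence (hq0 : q ≠ 0) (hq1 : ∀ n : ℕ, 0 < n → q ^ n ≠ 1) {a : ℕ}
    {A B : ℕ} {L : ℕ → ℤ} (hA : 1 ≤ A) (hAB : A ≤ B) (hB : B ≤ k) (hL : ∀ i, 0 ≤ L i)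
    (hk : ∀ i, k < i → L i = 0) (hz : ∀ i, 1 ≤ i → i < B → L i = 0) (F : (ℕ → ℤ) → K)
    (hF : ∀ L, F L = ∑ᶠ j, bosonicTerm q a (parityB k a (foldTail k L)) (foldTail k L) j)
    (hfold : ∀ L : ℕ → ℤ, F (L + Pi.single (k + 1) 1) = F (L + Pi.single k 1)) :
    F (L + Pi.single A 1 + Pi.single B 1)
      = F (L + Pi.single (A - 1) 1 + Pi.single (B + 1) 1)
        + q ^ (A * (∑ i ∈ Finset.Icc 1 (k + 1), L i + 1)) * F (L + Pi.single (B - A) 1) := by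
  have single_nonneg : ∀ j i : ℕ, 0 ≤ (Pi.single j 1 : ℕ → ℤ) i := fun j i => by
    rw [Pi.single_apply]; split_ifs <;> norm_num
  have hL' : ∀ j i : ℕ, 0 ≤ (L + Pi.single j 1 : ℕ → ℤ) i :=
    fun j i => add_nonneg (hL i) (single_nonneg j i)
  have hL'' : ∀ j j' i : ℕ, 0 ≤ (L + Pi.single j 1 + Pi.single j' 1 : ℕ → ℤ) i :=
    fun j j' i => add_nonneg (hL' j i) (single_nonneg j' i)
  have z0 : L (k + 1) = 0 := hk _ (by omega)
  have z1 : ∀ j, j ≤ k → (L + Pi.single j 1 : ℕ → ℤ) (k + 1) = 0 := fun j hj => by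
    simp [z0, show k + 1 ≠ j by omega]
  have z2 : ∀ j j', j ≤ k → j' ≤ k → (L + Pi.single j 1 + Pi.single j' 1 : ℕ → ℤ) (k + 1) = 0 :=
    fun j j' hj hj' => by simp [z0, show k + 1 ≠ j by omega, show k + 1 ≠ j' by omega]
  have s1 : ∀ j, j ≤ k → ∑ i ∈ Finset.range (k + 1), (i : ℤ) * (L + Pi.single j 1 : ℕ → ℤ) i
      = ∑ i ∈ Finset.range (k + 1), (i : ℤ) * L i + j := fun j hj => by
    rw [sum_range_mul_add_single k (fun i => (i : ℤ)) L (by omega), mul_one]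
  have s2 : ∀ j j', j ≤ k → j' ≤ k →
      ∑ i ∈ Finset.range (k + 1), (i : ℤ) * (L + Pi.single j 1 + Pi.single j' 1 : ℕ → ℤ) i
      = ∑ i ∈ Finset.range (k + 1), (i : ℤ) * L i + j + j' := fun j j' hj hj' => by
    rw [sum_range_mul_add_single k (fun i => (i : ℤ)) _ (by omega), s1 j hj, mul_one]
  set l := ∑ i ∈ Finset.range (k + 1), (i : ℤ) * L i with hl
  have hr := fun c => supernomial_mixed_recurrence hq0 hq1 hA hAB hB hL hz c
  have hrec := fun b => bosonicSum_add_mul (q := q) (k := k)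
    (fun c => abs_le_of_supernomial_ne_zero hq0 (hL'' (A - 1) (B + 1)) (c := c))
    (fun c => abs_le_of_supernomial_ne_zero hq0 (hL' (B - A)) (c := c)) _ hr a b
  have hS : ∀ {X : ℕ → ℤ}, X (k + 1) = 0 → supernomial q (k + 1) X = supernomial q k X :=
    fun hX => funext fun c => supernomial_succ_of_eq_zero hq0 hX c
  rw [hS (z2 A B (by omega) hB), hS (z1 (B - A) (by omega))] at hrec
  have hpar : (Odd (l + ((B - A : ℕ) : ℤ) + a + k)) ↔ Odd (l + A + B + a + k) := by
    rw [Nat.cast_sub hAB]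
    simp only [Int.odd_iff]
    omega
  have hF1 : F (L + Pi.single A 1 + Pi.single B 1) = _ :=
    (hF _).trans (finsum_bosonicTerm (z2 A B (by omega) hB) a)
  have hF2 : F (L + Pi.single (B - A) 1) = _ :=
    (hF _).trans (finsum_bosonicTerm (z1 (B - A) (by omega)) a)
  rw [s2 A B (by omega) hB] at hF1
  rw [s1 (B - A) (by omega)] at hF2
  simp only [hpar] at hF2
  rw [hF1, hF2, hrec]
  congr 1
  -- If B = k, the vector contains e_{k+1}. Replacing it by e_k lowers ℓ by one, which flips b just
  -- as the folding lemmas do.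
  rcases hB.eq_or_lt with rfl | hlt
  · rw [hfold]
    have hF3 : F (L + Pi.single (A - 1) 1 + Pi.single B 1) = _ :=
      (hF _).trans (finsum_bosonicTerm (z2 (A - 1) B (by omega) le_rfl) a)
    rw [s2 (A - 1) B (by omega) le_rfl] at hF3
    rw [hF3, Nat.cast_sub hA, Nat.cast_one]
    by_cases h : Odd (l + A + B + a + B)
    · have h' : ¬ Odd (l + (A - 1) + B + a + B) := by
        rw [Int.odd_iff] at *
        omega
      rw [if_pos h, if_neg h']
      refine bosonicSum_fold_odd hq0 hq1 (hL' (A - 1)) (z1 _ (by omega)) ?_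
      rw [s1 _ (by omega), Nat.cast_sub hA, Nat.cast_one]
      rw [Int.odd_iff] at h
      rw [Int.even_iff]
      omega
    · have h' : Odd (l + (A - 1) + B + a + B) := by
        rw [Int.odd_iff] at *
        omega
      rw [if_neg h, if_pos h']
      refine bosonicSum_fold_even hq0 hq1 (hL' (A - 1)) (z1 _ (by omega)) ?_
      rw [s1 _ (by omega), Nat.cast_sub hA, Nat.cast_one]
      rw [Int.odd_iff] at h
      rw [Int.even_iff]
      omega
  · have hF3 : F (L + Pi.single (A - 1) 1 + Pi.single (B + 1) 1) = _ :=
      (hF _).trans (finsum_bosonicTerm (z2 (A - 1) (B + 1) (by omega) hlt) a)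
    rw [s2 (A - 1) (B + 1) (by omega) hlt] at hF3
    have hpar' : Odd (l + ((A - 1 : ℕ) : ℤ) + ((B + 1 : ℕ) : ℤ) + a + k)
        ↔ Odd (l + A + B + a + k) := by
      rw [Nat.cast_sub hA]
      push_cast
      simp only [Int.odd_iff]
      omega
    simp only [hpar'] at hF3
    rw [hF3, hS (z2 (A - 1) (B + 1) (by omega) hlt)]

/-- The coefficient for e_B vanishes for |c| > B/2 and B ≤ k < b, so only j = 0 in the first half
can survive, with c = (b - a)/2. The parity rule makes c + B/2 an integer, and c ≤ B/2 amounts to k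
+ 1 ≤ B + a. -/
theorem bosonic_single (hq0 : q ≠ 0) (hq1 : ∀ n : ℕ, 0 < n → q ^ n ≠ 1) {a : ℕ}
    (ha : 1 ≤ a) (hak : a ≤ k + 1) {B : ℕ} (hB : B ≤ k) :
    ∑ᶠ j, bosonicTerm q a (parityB k a (foldTail k (Pi.single B 1)))
      (foldTail k (Pi.single B 1)) j = if k + 1 ≤ B + a then 1 else 0 := by
  have hl : ∑ i ∈ Finset.range (k + 1), (i : ℤ) * (Pi.single B 1 : ℕ → ℤ) i = B := by
    have s := sum_range_mul_add_single k (fun i => (i : ℤ)) 0 (show B < k + 1 by omega) 1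
    simpa using s
  rw [finsum_bosonicTerm (Pi.single_eq_of_ne (by omega) _), hl]
  have hz : ∀ c : ℚ, (B : ℚ) / 2 < c ∨ c < -((B : ℚ) / 2) →
      supernomial q k (Pi.single B 1) c = 0 := by
    intro c hc
    by_contra h
    have := abs_le_of_supernomial_ne_zero hq0 (fun i => by
      rw [Pi.single_apply]; split_ifs <;> norm_num) h
    rw [hl, abs_le] at this
    push_cast at this
    rcases hc with hc | hc <;> linarith [this.1, this.2]
  set b := if Odd ((B : ℤ) + a + k) then k + 1 else k + 2 with hb
  have hb1 : k + 1 ≤ b ∧ b ≤ k + 2 := by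
    rw [hb]; split_ifs <;> omega
  have hpar : (b : ℤ) % 2 = (B + a) % 2 := by
    rw [hb]
    split_ifs with h <;> rw [Int.odd_iff] at h <;> push_cast <;> omega
  have q1 : (k : ℚ) + 1 ≤ b := by exact_mod_cast hb1.1
  have q2 : (b : ℚ) ≤ k + 2 := by exact_mod_cast hb1.2
  have q3 : (1 : ℚ) ≤ a := by exact_mod_cast ha
  have q4 : (a : ℚ) ≤ k + 1 := by exact_mod_cast hak
  have q5 : (B : ℚ) ≤ k := by exact_mod_cast hB
  have q6 : (0 : ℚ) ≤ k := Nat.cast_nonneg k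
  have hpos : ∀ j : ℤ, 1 ≤ j → (2 * (k : ℚ) + 3) ≤ (2 * k + 3) * j := by
    intro j hj
    have : (1 : ℚ) ≤ j := by exact_mod_cast hj
    nlinarith
  have hneg : ∀ j : ℤ, j ≤ -1 → (2 * (k : ℚ) + 3) * j ≤ -(2 * k + 3) := by
    intro j hj
    have : (j : ℚ) ≤ -1 := by exact_mod_cast hj
    nlinarith
  have h2 : ∀ j : ℤ, supernomial q k (Pi.single B 1) (((b : ℚ) + a) / 2 + (2 * k + 3) * j) = 0 := by
    intro j
    refine hz _ ?_
    rcases lt_trichotomy j 0 with hj | rfl | hj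
    · right; linarith [hneg j (by omega)]
    · left; push_cast; linarith
    · left; linarith [hpos j (by omega)]
  rw [bosonicSum, finsum_eq_single _ 0]
  · rw [h2]
    simp only [Int.cast_zero, mul_zero, add_zero, zero_mul, zpow_zero, one_mul, sub_zero]
    split_ifs with h
    · refine supernomial_single hq0 hq1 hB (J := (b - a + B) / 2) ?_ ?_ ?_
      · obtain ⟨m, hm⟩ : ∃ m : ℤ, (b : ℤ) - a + B = 2 * m := ⟨((b : ℤ) - a + B) / 2, by omega⟩
        have hmq : (b : ℚ) - a + B = 2 * m := by exact_mod_cast hm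
        rw [hm, Int.mul_ediv_cancel_left _ (by norm_num)]
        linarith
      · omega
      · omega
    · refine hz _ (Or.inl ?_)
      have : (B : ℚ) + a < k + 1 := by exact_mod_cast not_le.1 h
      linarith
  · intro j hj
    rw [h2, hz, mul_zero, mul_zero, sub_zero]
    rcases lt_or_gt_of_ne hj with hj | hj
    · right; linarith [hneg j (by omega)]
    · left; linarith [hpos j (by omega)]

end Bosonic

/-! ### Comparison of the two sums. -/

section Main

variable {K : Type*} [Field K] {q : K} {k : ℕ}

theorem topVec_congr {a : ℕ} (ha : 1 ≤ a) (hak : a ≤ k + 1) {L L' : ℕ → ℤ}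
    (h : foldTail k L = foldTail k L') : topVec k a L = topVec k a L' :=
  tadpole_mulVec_injective k (funext fun i => by
    rw [tadpole_mulVec_topVec ha hak, tadpole_mulVec_topVec ha hak, h])

theorem foldTail_congr {L L' : ℕ → ℤ} (h : ∀ i, 1 ≤ i → L i = L' i) :
    foldTail k L = foldTail k L' :=
  funext fun i => by rw [foldTail, foldTail, h _ (by omega), h _ (by omega)]

theorem foldTail_add_single_succ (L : ℕ → ℤ) :
    foldTail k (L + Pi.single (k + 1) 1) = foldTail k (L + Pi.single k 1) := by
  funext i
  have := i.isLt
  simp only [foldTail, Pi.add_apply, Pi.single_apply]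
  split_ifs <;> omega

/-- The difference of the two sums satisfies the common mixed recurrence, depends only on the folded
vector, and vanishes at every e_B. -/
theorem fermionic_eq_bosonic (hq0 : q ≠ 0) (hq1 : ∀ n : ℕ, 0 < n → q ^ n ≠ 1) {a : ℕ}
    (hk : 1 ≤ k) (ha : 1 ≤ a) (hak : a ≤ k + 1) {L : ℕ → ℤ} (hL : ∀ i, 0 ≤ L i)
    (hLk : ∀ i, k < i → L i = 0) :
    ∑ᶠ n, fermionicTerm q a (topVec k a L) n
      = ∑ᶠ j, bosonicTerm q a (parityB k a (foldTail k L)) (foldTail k L) j := by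
  set G : (ℕ → ℤ) → K := fun L => ∑ᶠ n, fermionicTerm q a (topVec k a L) n with hG
  set F : (ℕ → ℤ) → K :=
    fun L => ∑ᶠ j, bosonicTerm q a (parityB k a (foldTail k L)) (foldTail k L) j with hF
  have hGc : ∀ L L' : ℕ → ℤ, foldTail k L = foldTail k L' → G L = G L' := fun L L' h => by
    simp only [hG, topVec_congr ha hak h]
  have hFc : ∀ L L' : ℕ → ℤ, foldTail k L = foldTail k L' → F L = F L' := fun L L' h => by
    simp only [hF, h]
  have main := eq_zero_of_mixed_recurrence (k := k) (F := fun L => G L - F L)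
    (fun A _ L => q ^ (A * (∑ i ∈ Finset.Icc 1 (k + 1), L i + 1)))
    (fun L L' h => by simp only [hGc L L' (foldTail_congr h), hFc L L' (foldTail_congr h)])
    (fun L => by simp only [hGc _ _ (foldTail_add_single_succ L),
      hFc _ _ (foldTail_add_single_succ L)])
    (fun A B L hA hAB hB hL hLk hz => by
      have h1 := mixed_recurrence hq0 (G := G) (k := k)
        (fun L => hGc _ _ (foldTail_congr fun i hi => by simp [show i ≠ 0 by omega]))
        (fun A L hA hAk hn hk => fermionic_quadratic_recurrence hq0 hq1 ha hak A L hA hAk hn hk)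
        A B L hA hAB hB hz (fun i _ => by have := hL i; omega) (fun i _ => hL i)
      have h2 := bosonic_mixed_recurrence hq0 hq1 hA hAB hB hL hLk hz F (fun _ => rfl)
        (fun L => hFc _ _ (foldTail_add_single_succ L))
      simp only [h1, h2]
      ring)
    (fun B hB => by
      simp only [hG, hF]
      rw [fermionic_single hq0 hq1 hk ha hak hB, bosonic_single hq0 hq1 ha hak hB, sub_self])
    L hL hLk
  exact sub_eq_zero.1 main

end Main

end Supernomial

theorem theorem4p2 {K : Type*} [Field K] (q : K) (hq0 : q ≠ 0) (hq1 : ∀ n : ℕ, 0 < n → q ^ n ≠ 1)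
    (k a : ℕ) (hk : 1 ≤ k) (ha1 : 1 ≤ a) (hak : a ≤ k + 1)
    (M L : Fin k → ℤ) (b : ℕ)
    (hL : L = Supernomial.vecL a M) (hL0 : ∀ i, 0 ≤ L i)
    (hb : b = Supernomial.parityB k a L) :
    (Function.support fun n : Fin k → ℤ => Supernomial.fTerm q a n M).Finite ∧
    (Function.support fun j : ℤ => Supernomial.bosonicTerm q a b L j).Finite ∧
    Supernomial.coeffP q a M = ∑ᶠ j : ℤ, Supernomial.bosonicTerm q a b L j ∧
    (Function.support fun n : Fin k → ℤ => Supernomial.fermionicTerm q a M n).Finite ∧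
    ∑ᶠ n : Fin k → ℤ, Supernomial.fermionicTerm q a M n
      = ∑ᶠ j : ℤ, Supernomial.bosonicTerm q a b L j := by
  open Supernomial in
  -- L as a sequence with entries at 1, …, k and zeros elsewhere, the form in which the recurrences
  -- are stated.
  set X : ℕ → ℤ := fun i => if h : 1 ≤ i ∧ i ≤ k then L ⟨i - 1, by omega⟩ else 0 with hX
  have hX0 : ∀ i, 0 ≤ X i := fun i => by
    simp only [hX]
    split_ifs
    · exact hL0 _
    · exact le_rfl
  have hXk : ∀ i, k < i → X i = 0 := fun i hi => by
    simp only [hX]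
    rw [dif_neg (by omega)]
  have hXL : L = fun i : Fin k => X (i + 1) := by
    funext i
    have := i.isLt
    simp only [hX]
    rw [dif_pos (by omega)]
    rfl
  have hfold : foldTail k X = L := by
    rw [foldTail_of_eq_zero (hXk _ (by omega)), hXL]
  have hM : topVec k a X = M := by
    refine tadpole_mulVec_injective k (funext fun i => ?_)
    rw [tadpole_mulVec_topVec ha1 hak, hfold, hL]
    simp only [vecL, Pi.add_apply, Pi.sub_apply]
    ring
  have hT : ∀ i, -1 ≤ (tadpole k *ᵥ M) i := fun i => by
    rw [← hM]
    exact neg_one_le_tadpole_mulVec_topVec ha1 hak (fun i _ => by have := hX0 i; omega)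
      (fun i _ => hX0 i) i
  have hfin := finite_support_fermionicTerm hq0 a hT
  have heq := fermionic_eq_bosonic hq0 hq1 hk ha1 hak hX0 hXk
  rw [hM, hfold, ← hb] at heq
  have hbos : (Function.support fun j : ℤ => bosonicTerm q a b L j).Finite := by
    rw [hXL]
    exact finite_support_bosonicSum
      (fun c => abs_le_of_supernomial_ne_zero (q := q) hq0 (N := k) hX0 (c := c)) a b
  refine ⟨?_, hbos, ?_, hfin, heq⟩
  · simp only [fTerm_eq_fermionicTerm hq0 hq1]
    exact hfin
  · simp only [coeffP, fTerm_eq_fermionicTerm hq0 hq1]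
    exact heq
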